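/- Let $m>0$ and let $\beta,\alpha^1,\alpha^2,\alpha^3$ be the $4\times4$ Dirac matrices $\beta=\begin{pmatrix}I&0\\0&-I\end{pmatrix}$, $\alpha^k=\begin{pmatrix}0&\sigma^k\\\sigma^k&0\end{pmatrix}$, with the Pauli matrices $\sigma^1=\begin{pmatrix}0&1\\1&0\end{pmatrix}$, $\sigma^2=\begin{pmatrix}0&-i\\i&0\end{pmatrix}$, $\sigma^3=\begin{pmatrix}1&0\\0&-1\end{pmatrix}$. Let $H=-i\boldsymbol\alpha\cdot\nabla+m\beta$ be the Dirac operator in $L^2(\mathbb R^3,\mathbb C^4)$, let $\Lambda_\pm$ be the orthogonal projectors on its positive and negative spectral subspaces, and let $X=H^{1/2}(\mathbb R^3,\mathbb C^4)$ with the norm $\|\psi\|^2=\int_{\mathbb R^3}\sqrt{|\xi|^2+m^2}\,|\hat\psi(\xi)|^2\,d\xi$ ($\hat\psi$ the unitary Fourier transform). Write $|\cdot|_p$ for the $L^p$ norm, $X_\pm=\Lambda_\pm X$, $\Sigma_+=\{w\in X_+:|w|_2=1\}$, and let $S_p$ be the best constant in $|\psi|_p\le S_p\|\psi\|$, $\psi\in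 X$, for $2\le p\le3$. Let $F\in C^2(\mathbb C^4,\mathbb R)$ (with $\mathbb C^4$ seen as a real Euclidean space with scalar product $\operatorname{Re}\langle\cdot,\cdot\rangle$, with respect to which $\nabla F$ and $D^2F$ are taken) be such that for some $\alpha\in(2,\frac83]$, $R>0$, $\bar\gamma>0$, $\rho>0$, $\nu\in(\frac\alpha2,\frac32)$: * $\nabla F(0)=0$ and $D^2F(0)=0$; * $|D^2F(\phi)|\le|\phi|^{\alpha-2}$ whenever $|\phi|\ge R$; * $\operatorname{Re}\langle\nabla F(\phi),\phi\rangle\ge\alpha F(\phi)\ge0$ for all $\phi\in\mathbb C^4$; * $\operatorname{Re}\langle D^2F(\phi)\xi,\xi\rangle\ge0$ for all $\phi,\xi\in\mathbb C^4$; * $F(\phi)\ge\bar\gamma\,|\langle\phi,\beta\phi\rangle|^{\alpha/2}$ whenever $|\phi|<\rho$; * $|\nabla F(\phi)|\le|\phi|^\nu$ whenever $|\phi|<\rho$. Let $\mu$ be a constant with $|\nabla F(\phi)|\le|\phi|+\mu|\phi|^{\alpha-1}$ for all $\phi\in\mathbb C^4$. Let $\lambda\in(0,1]$, let $\gamma_0>0$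 satisfy $$\gamma_0\Big(S_2^2+\mu\lambda^{\frac{\alpha-2}2}S_3^{3(\alpha-2)}S_2^{3\alpha-8}\Big)<\tfrac1{16},\qquad \gamma_0\Big(S_2^2+\mu\lambda^{\frac{\alpha-2}2}S_{\frac4{4-\alpha}}^2\Big)<\tfrac14,$$ and let $\gamma\in(0,\gamma_0]$. For $\psi\in X$ put $$I(\psi)=\tfrac12\|\Lambda_+\psi\|^2-\tfrac12\|\Lambda_-\psi\|^2-\gamma\int_{\mathbb R^3}F(\psi)\,dx,$$ and with $B_\lambda=\{\eta\in X_-:|\eta|_2^2<\lambda\}$ define $$\mathcal E(w)=\sup_{\eta\in B_\lambda}I\big(\sqrt{\lambda-|\eta|_2^2}\;w+\eta\big)\quad(w\in\Sigma_+),\qquad e(\lambda)=\inf_{w\in\Sigma_+}\mathcal E(w).$$ Then $0<e(\lambda)<\dfrac{\lambda m}{2}$. -/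

import Mathlib

open MeasureTheory FourierTransform
open scoped SchwartzMap ENNReal

noncomputable section

namespace NLDirac

/-- Physical space. -/
abbrev R3 : Type := EuclideanSpace ℝ (Fin 3)

/-- The space of spinors, with its Hermitian norm; as a real space its inner product is
the real part of the Hermitian product. -/
abbrev C4 : Type := EuclideanSpace ℂ (Fin 4)

/-- The complex Hilbert space of square integrable spinor fields. -/
abbrev L2 : Type := Lp C4 2 (volume : Measure R3)

/-! ### The Dirac operator -/

/-- The three Pauli matrices. -/
def pauli : Fin 3 → Matrix (Fin 2) (Fin 2) ℂ :=
  ![!![0, 1; 1, 0], !![0, -Complex.I; Complex.I, 0], !![1, 0; 0, -1]]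

/-- A `4 × 4` matrix given by `2 × 2` blocks. -/
def blocks (A B C D : Matrix (Fin 2) (Fin 2) ℂ) : Matrix (Fin 4) (Fin 4) ℂ :=
  (Matrix.fromBlocks A B C D).reindex finSumFinEquiv finSumFinEquiv

/-- The Dirac matrix `β`. -/
def beta : Matrix (Fin 4) (Fin 4) ℂ := blocks 1 0 0 (-1)

/-- The Dirac matrices `α¹, α², α³`. -/
def alpha (k : Fin 3) : Matrix (Fin 4) (Fin 4) ℂ := blocks 0 (pauli k) (pauli k) 0

/-- A `4 × 4` matrix acting on spinors. -/
def act (M : Matrix (Fin 4) (Fin 4) ℂ) : C4 →L[ℂ] C4 := Matrix.toEuclideanCLM (𝕜 := ℂ) M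

/-- The symbol of `√(-Δ + m²)`. Mathlib's Fourier transform has the kernel `exp (-2πi x·ξ)`, so
that the operator `-i∇` corresponds to multiplication by `2πξ`. -/
def energy (m : ℝ) (ξ : R3) : ℝ := √((2 * Real.pi * ‖ξ‖) ^ 2 + m ^ 2)

/-- The symbol of the Dirac operator `H = -i α·∇ + m β`. -/
def diracSymbol (m : ℝ) (ξ : R3) : Matrix (Fin 4) (Fin 4) ℂ :=
  ∑ k, ((2 * Real.pi * ξ k : ℝ) : ℂ) • alpha k + (m : ℂ) • beta

/-- The symbol `(1 + H / |H|) / 2` of the projector on the positive spectral subspace of `H`. -/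
def posSymbol (m : ℝ) (ξ : R3) : Matrix (Fin 4) (Fin 4) ℂ :=
  (1 / 2 : ℂ) • (1 + ((energy m ξ)⁻¹ : ℂ) • diracSymbol m ξ)

/-- The symbol is Hermitian and squares to `|p|² + m²`, so that its positive spectral projector is
the matrix `posSymbol`. -/
lemma diracSymbol_isHermitian (m : ℝ) (ξ : R3) : (diracSymbol m ξ).IsHermitian := by
  ext i j
  fin_cases i <;> fin_cases j <;>
    simp [diracSymbol, Fin.sum_univ_three, alpha, beta, blocks, pauli, Matrix.fromBlocks,
      finSumFinEquiv, Fin.addCases, Matrix.conjTranspose_apply]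

lemma diracSymbol_mul_self (m : ℝ) (ξ : R3) :
    diracSymbol m ξ * diracSymbol m ξ = ((energy m ξ ^ 2 : ℝ) : ℂ) • 1 := by
  have h : energy m ξ ^ 2 = (2 * Real.pi) ^ 2 * (ξ 0 ^ 2 + ξ 1 ^ 2 + ξ 2 ^ 2) + m ^ 2 := by
    rw [energy, Real.sq_sqrt (by positivity), mul_pow, EuclideanSpace.real_norm_sq_eq,
      Fin.sum_univ_three]
  rw [h]
  ext i j
  fin_cases i <;> fin_cases j <;>
    simp [diracSymbol, Fin.sum_univ_three, alpha, beta, blocks, pauli, Matrix.fromBlocks,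
      finSumFinEquiv, Fin.addCases, Matrix.mul_apply, Fin.sum_univ_four] <;>
    ring_nf <;> simp

lemma memLp_posSymbol (m : ℝ) (f : L2) :
    MemLp (fun ξ => act (posSymbol m ξ) (f ξ)) 2 (volume : Measure R3) := by
  have hE : Measurable (energy m) := by unfold energy; fun_prop
  have key : ∀ (c : R3 → ℝ) (A : Matrix (Fin 4) (Fin 4) ℂ), Measurable c → (∀ ξ, |c ξ| ≤ 1) →
      MemLp (fun ξ => (c ξ : ℂ) • act A (f ξ)) 2 (volume : Measure R3) := by
    intro c A hc hb
    have h1 : MemLp (fun ξ => act A (f ξ)) 2 (volume : Measure R3) :=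
      (act A).comp_memLp' (Lp.memLp f)
    refine h1.mono ?_ (Filter.Eventually.of_forall fun ξ => ?_)
    · exact (Complex.measurable_ofReal.comp hc).aestronglyMeasurable.smul h1.1
    · rw [norm_smul, Complex.norm_real, Real.norm_eq_abs]
      exact mul_le_of_le_one_left (norm_nonneg _) (hb ξ)
  have hbd : ∀ (ξ : R3) (t : ℝ), t ^ 2 ≤ (2 * Real.pi * ‖ξ‖) ^ 2 + m ^ 2 →
      |(energy m ξ)⁻¹ * t| ≤ 1 := by
    intro ξ t ht
    have h0 : 0 ≤ energy m ξ := Real.sqrt_nonneg _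
    rw [abs_mul, abs_of_nonneg (inv_nonneg.2 h0), inv_mul_eq_div]
    exact div_le_one_of_le₀ (Real.abs_le_sqrt ht) h0
  have hα : ∀ k, MemLp (fun ξ : R3 => (((energy m ξ)⁻¹ * (2 * Real.pi * ξ k) : ℝ) : ℂ) •
      act (alpha k) (f ξ)) 2 (volume : Measure R3) := by
    intro k
    refine key _ _ (by fun_prop) fun ξ => hbd ξ _ ?_
    have h2 : ξ k ^ 2 ≤ ‖ξ‖ ^ 2 := by
      rw [← sq_abs]
      gcongr
      exact PiLp.norm_apply_le ξ k
    rw [mul_pow, mul_pow]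
    nlinarith [sq_nonneg m, mul_le_mul_of_nonneg_left h2 (sq_nonneg (2 * Real.pi))]
  have hβ : MemLp (fun ξ : R3 => (((energy m ξ)⁻¹ * m : ℝ) : ℂ) •
      act beta (f ξ)) 2 (volume : Measure R3) :=
    key _ _ (by fun_prop) fun ξ => hbd ξ _ (by nlinarith [sq_nonneg (2 * Real.pi * ‖ξ‖)])
  have hsum := (((Lp.memLp f).add (((hα 0).add (hα 1)).add (hα 2))).add hβ).const_smul (1 / 2 : ℂ)
  refine (memLp_congr_ae (Filter.Eventually.of_forall fun ξ => ?_)).2 hsum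
  have hact : ∀ (M N : Matrix (Fin 4) (Fin 4) ℂ) (v : C4), act (M + N) v = act M v + act N v := by
    intro M N v; simp [act, map_add]
  have hsm : ∀ (c : ℂ) (M : Matrix (Fin 4) (Fin 4) ℂ) (v : C4), act (c • M) v = c • act M v := by
    intro c M v; simp [act, map_smul]
  have h1 : ∀ v : C4, act 1 v = v := by intro v; simp [act, map_one]
  simp only [posSymbol, diracSymbol, Fin.sum_univ_three, hact, hsm, h1, Pi.add_apply,
    Pi.smul_apply, smul_add, smul_smul]
  push_cast
  module

/-- The projector `Λ₊` on the positive spectral subspace of `H`. -/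
def posProj (m : ℝ) (ψ : L2) : L2 := 𝓕⁻ ((memLp_posSymbol m (𝓕 ψ)).toLp _)

/-- The projector `Λ₋` on the negative spectral subspace of `H`; as `0` is not in the spectrum
of `H`, it is `1 - Λ₊`. -/
def negProj (m : ℝ) (ψ : L2) : L2 := ψ - posProj m ψ

/-! ### The energy space -/

/-- The Sobolev space `X = H^{1/2}(ℝ³, ℂ⁴)`. -/
def X : Set L2 := {ψ | TemperedDistribution.MemSobolev (1 / 2) 2 (ψ : 𝓢'(R3, C4))}

/-- The integral in the norm below is finite exactly on `X`. -/
lemma mem_X_iff {m : ℝ} (hm : 0 < m) (ψ : L2) :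
    ψ ∈ X ↔ Integrable (fun ξ : R3 => energy m ξ * ‖(𝓕 ψ : L2) ξ‖ ^ 2) := by
  set g : R3 → ℂ := fun x => ((1 + ‖x‖ ^ 2) ^ ((1 / 2 : ℝ) / 2) : ℝ) with hg
  have hgt : g.HasTemperateGrowth := by rw [hg]; fun_prop
  set φ : L2 := 𝓕 ψ with hφ
  have hgφm : AEStronglyMeasurable (fun ξ => g ξ • φ ξ) (volume : Measure R3) :=
    hgt.1.continuous.aestronglyMeasurable.smul (Lp.aestronglyMeasurable φ)
  have hg2 : ∀ ξ : R3, ‖g ξ • φ ξ‖ ^ 2 = √(1 + ‖ξ‖ ^ 2) * ‖φ ξ‖ ^ 2 := by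
    intro ξ
    have h0 : (0 : ℝ) ≤ 1 + ‖ξ‖ ^ 2 := by positivity
    rw [norm_smul, mul_pow, hg, Complex.norm_real, Real.norm_eq_abs, sq_abs, ← Real.rpow_natCast,
      ← Real.rpow_mul h0, Real.sqrt_eq_rpow]
    norm_num
  have hiff : Integrable (fun ξ : R3 => energy m ξ * ‖φ ξ‖ ^ 2) ↔
      MemLp (fun ξ => g ξ • φ ξ) 2 (volume : Measure R3) := by
    rw [memLp_two_iff_integrable_sq_norm hgφm]
    simp only [hg2]
    have hφm : AEStronglyMeasurable (fun ξ => ‖φ ξ‖ ^ 2) (volume : Measure R3) :=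
      (Lp.aestronglyMeasurable φ).norm.pow 2
    have hEm : AEStronglyMeasurable (energy m) (volume : Measure R3) := by
      have : Continuous (energy m) := by unfold energy; fun_prop
      exact this.aestronglyMeasurable
    have hSm : AEStronglyMeasurable (fun ξ : R3 => √(1 + ‖ξ‖ ^ 2)) (volume : Measure R3) := by
      have : Continuous (fun ξ : R3 => √(1 + ‖ξ‖ ^ 2)) := by fun_prop
      exact this.aestronglyMeasurable
    constructor
    · intro h
      refine (h.const_mul (1 + m⁻¹)).mono (hSm.mul hφm) (Filter.Eventually.of_forall fun ξ => ?_)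
      have hE0 : 0 ≤ energy m ξ := Real.sqrt_nonneg _
      have hmi : 0 < m⁻¹ := inv_pos.2 hm
      have : √(1 + ‖ξ‖ ^ 2) ≤ (1 + m⁻¹) * energy m ξ := by
        apply Real.sqrt_le_iff.2 ⟨by positivity, ?_⟩
        rw [mul_pow, energy, Real.sq_sqrt (by positivity)]
        have h3 : m⁻¹ * m = 1 := inv_mul_cancel₀ hm.ne'
        have hp : 1 ≤ 2 * Real.pi := by linarith [Real.pi_gt_three]
        have hx : ‖ξ‖ ^ 2 ≤ (2 * Real.pi * ‖ξ‖) ^ 2 := by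
          gcongr
          exact le_mul_of_one_le_left (norm_nonneg _) hp
        have h4 : (1 : ℝ) ≤ (1 + m⁻¹) ^ 2 * m ^ 2 := by
          rw [← mul_pow]
          exact one_le_pow₀ (by nlinarith)
        have h5 : ‖ξ‖ ^ 2 ≤ (1 + m⁻¹) ^ 2 * (2 * Real.pi * ‖ξ‖) ^ 2 :=
          hx.trans (le_mul_of_one_le_left (by positivity) (one_le_pow₀ (by linarith)))
        linarith
      rw [norm_mul, norm_mul, norm_mul, Real.norm_of_nonneg (Real.sqrt_nonneg _),
        Real.norm_of_nonneg hE0, Real.norm_of_nonneg (by positivity : 0 ≤ 1 + m⁻¹), ← mul_assoc]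
      gcongr
    · intro h
      refine (h.const_mul (2 * Real.pi + m)).mono (hEm.mul hφm)
        (Filter.Eventually.of_forall fun ξ => ?_)
      have hE0 : 0 ≤ energy m ξ := Real.sqrt_nonneg _
      have hπ := Real.pi_pos
      have : energy m ξ ≤ (2 * Real.pi + m) * √(1 + ‖ξ‖ ^ 2) := by
        apply Real.sqrt_le_iff.2 ⟨by positivity, ?_⟩
        rw [mul_pow _ (√_), Real.sq_sqrt (by positivity)]
        nlinarith [mul_pos hπ hm, sq_nonneg ‖ξ‖, sq_nonneg m, sq_nonneg Real.pi,
          mul_nonneg (mul_pos hπ hm).le (sq_nonneg ‖ξ‖),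
          mul_nonneg (sq_nonneg m) (sq_nonneg ‖ξ‖)]
      rw [norm_mul, norm_mul, norm_mul, Real.norm_of_nonneg (Real.sqrt_nonneg _),
        Real.norm_of_nonneg hE0, Real.norm_of_nonneg (by positivity : 0 ≤ 2 * Real.pi + m),
        ← mul_assoc]
      gcongr
  rw [hiff, X, Set.mem_ofPred_eq, TemperedDistribution.memSobolev_iff_exists_smulLeftCLM_fourier,
    Lp.fourier_toTemperedDistribution_eq]
  have htest : ∀ u : 𝓢(R3, ℂ), TemperedDistribution.smulLeftCLM C4 g (φ : 𝓢'(R3, C4)) u =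
      ∫ x : R3, u x • (g x • φ x) := by
    intro u
    rw [TemperedDistribution.smulLeftCLM_apply_apply, Lp.toTemperedDistribution_apply]
    refine integral_congr_ae (Filter.Eventually.of_forall fun x => ?_)
    simp [SchwartzMap.smulLeftCLM_apply_apply hgt, smul_smul, mul_comm]
  constructor
  · rintro ⟨f', hf'⟩
    have hli : LocallyIntegrable (fun ξ => g ξ • φ ξ) (volume : Measure R3) :=
      LocallyIntegrable.continuous_smul hgt.1.continuous
        ((Lp.memLp φ).locallyIntegrable (by norm_num))
    have hae : (fun ξ => g ξ • φ ξ) =ᵐ[volume] f' := by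
      refine ae_eq_of_integral_contDiff_smul_eq hli
        ((Lp.memLp f').locallyIntegrable (by norm_num)) fun u hu hc => ?_
      have hg₁ : HasCompactSupport (Complex.ofRealCLM ∘ u) := hc.comp_left rfl
      have hg₂ : ContDiff ℝ ((⊤ : ℕ∞) : WithTop ℕ∞) (Complex.ofRealCLM ∘ u) := by fun_prop
      have h := htest (hg₁.toSchwartzMap hg₂)
      rw [hf', Lp.toTemperedDistribution_apply] at h
      simpa using h.symm
    exact (memLp_congr_ae hae).2 (Lp.memLp f')
  · intro h
    refine ⟨h.toLp _, ?_⟩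
    ext1 u
    rw [htest, Lp.toTemperedDistribution_apply]
    refine integral_congr_ae ?_
    filter_upwards [h.coeFn_toLp] with x hx
    rw [hx]

/-- The norm of `X`, with `‖ψ‖² = ∫ √(|p|² + m²) |ψ̂(p)|² dp`. -/
def hNorm (m : ℝ) (ψ : L2) : ℝ := √(∫ ξ : R3, energy m ξ * ‖(𝓕 ψ : L2) ξ‖ ^ 2)

/-- The best constant, in `[0, ∞]`, of the embedding of `X` into `L^p`. -/
def sobolevConst (m : ℝ) (p : ℝ≥0∞) : ℝ≥0∞ :=
  sInf {C | ∀ ψ ∈ X, eLpNorm ψ p (volume : Measure R3) ≤ C * ENNReal.ofReal (hNorm m ψ)}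

/-- `X₊ = Λ₊ X`. -/
def Xpos (m : ℝ) : Set L2 := posProj m '' X

/-- `X₋ = Λ₋ X`. -/
def Xneg (m : ℝ) : Set L2 := negProj m '' X

/-- `Σ₊`, the unit sphere for the `L²` norm in `X₊`. -/
def sphere (m : ℝ) : Set L2 := {w | w ∈ Xpos m ∧ ‖w‖ ^ 2 = 1}

/-- `B_λ`. -/
def ball (m lam : ℝ) : Set L2 := {η | η ∈ Xneg m ∧ ‖η‖ ^ 2 < lam}

/-! ### The nonlinearity and the functionals -/

/-- The assumptions on the nonlinearity `F`. Derivatives are real Fréchet derivatives, so that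
`⟨∇F(φ), ξ⟩ = fderiv ℝ F φ ξ` and `⟨D²F(φ) ξ, ζ⟩ = fderiv ℝ (fderiv ℝ F) φ ξ ζ`. -/
structure Nonlinearity (F : C4 → ℝ) (α R γbar ρ ν : ℝ) : Prop where
  two_lt_alpha : 2 < α
  alpha_le : α ≤ 8 / 3
  R_pos : 0 < R
  gammabar_pos : 0 < γbar
  rho_pos : 0 < ρ
  alpha_half_lt_nu : α / 2 < ν
  nu_lt : ν < 3 / 2
  contDiff : ContDiff ℝ 2 F
  grad_zero : fderiv ℝ F 0 = 0
  hess_zero : fderiv ℝ (fderiv ℝ F) 0 = 0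
  hess_le : ∀ φ, R ≤ ‖φ‖ → ‖fderiv ℝ (fderiv ℝ F) φ‖ ≤ ‖φ‖ ^ (α - 2)
  superquadratic : ∀ φ, α * F φ ≤ fderiv ℝ F φ φ
  nonneg : ∀ φ, 0 ≤ α * F φ
  convex : ∀ φ ξ, 0 ≤ fderiv ℝ (fderiv ℝ F) φ ξ ξ
  lower : ∀ φ, ‖φ‖ < ρ → γbar * ‖inner ℂ φ (act beta φ)‖ ^ (α / 2) ≤ F φ
  grad_le : ∀ φ, ‖φ‖ < ρ → ‖fderiv ℝ F φ‖ ≤ ‖φ‖ ^ ν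

/-- The functional `I(ψ) = ½ ‖Λ₊ψ‖² - ½ ‖Λ₋ψ‖² - γ ∫ F(ψ)`. -/
def action (F : C4 → ℝ) (m γ : ℝ) (ψ : L2) : ℝ :=
  1 / 2 * hNorm m (posProj m ψ) ^ 2 - 1 / 2 * hNorm m (negProj m ψ) ^ 2
    - γ * ∫ x : R3, F (ψ x)

/-- `a(η) = √(λ - |η|₂²)`. -/
def coeff (lam : ℝ) (η : L2) : ℝ := √(lam - ‖η‖ ^ 2)

/-- `J_w(η) = I(a(η) w + η)`. -/
def J (F : C4 → ℝ) (m γ lam : ℝ) (w η : L2) : ℝ :=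
  action F m γ ((coeff lam η : ℂ) • w + η)

/-- The reduced functional `E(w) = sup_{η ∈ B_λ} J_w(η)`, the supremum being taken in
`[-∞, ∞]`. -/
def E (F : C4 → ℝ) (m γ lam : ℝ) (w : L2) : EReal :=
  ⨆ η ∈ ball m lam, (J F m γ lam w η : EReal)

/-- The min-max level `e(λ) = inf_{w ∈ Σ₊} E(w)`, the infimum being taken in `[-∞, ∞]`. -/
def level (F : C4 → ℝ) (m γ lam : ℝ) : EReal :=
  ⨅ w ∈ sphere m, E F m γ lam w

end NLDirac

end

noncomputable section

namespace NLDirac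

/-! ### The projectors -/

/-! Positivity. Taking η = 0 in the supremum, it is enough to bound I(√λ w) from below uniformly in
w. Superquadraticity and the growth of ∇F give F(φ) ≤ ½(|φ|² + μ|φ|^α). Hölder and the Sobolev
embeddings, with the second smallness condition, turn this into γ₀∫F(ψ) ≤ ⅛‖ψ‖² whenever |ψ|₂² ≤ λ
(`mul_integral_nonlinearity_le`). Since m|w|₂² ≤ ‖w‖², every E(w) is at least ⅜λm (`level_pos`).

Strict upper bound. The trial spinor w comes from the first column of the symbol of Λ₊, cut off to
frequencies |ξ| ≤ r, transformed back and normalised (`exists_mem_sphere_concentrated`). As r → 0 it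
satisfies ‖w‖² ≤ m + O(r²) and |w|² = O(r³), while |⟨w, βw⟩| is at least of order r³ on a ball of
radius of order 1/r.

The bound must be uniform in η. With a² = λ - |η|₂², the quadratic part of I(aw + η) is at most λm/2
- m|η|₂² + O(r²). Convexity gives F(aw + η) ≥ F(aw) + ∇F(aw)·η. Young's inequality absorbs the
linear term into m|η|₂², up to an error O(r^(3(ν-1))) (`le_integral_nonlinearity_add`). If |η|₂² <
λ/2, then a² > λ/2 and γ∫F(aw) is at least of order r^(3α/2-3). This beats both errors for small r,
because α/2 < ν and 3α/2 - 3 < 2 (`eventually_mul_rpow_lt`). If |η|₂² ≥ λ/2, the term -m|η|₂²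
suffices, as F ≥ 0. -/

lemma act_mul (M N : Matrix (Fin 4) (Fin 4) ℂ) : act (M * N) = act M * act N := by
  simp [act, map_mul]

lemma act_conjTranspose (M : Matrix (Fin 4) (Fin 4) ℂ) : act M.conjTranspose = star (act M) := by
  rw [← Matrix.star_eq_conjTranspose]
  exact map_star (Matrix.toEuclideanCLM (𝕜 := ℂ) (n := Fin 4)) M

lemma le_energy {m : ℝ} (ξ : R3) : m ≤ energy m ξ :=
  Real.le_sqrt_of_sq_le (by nlinarith [sq_nonneg (2 * Real.pi * ‖ξ‖)])

lemma energy_pos {m : ℝ} (hm : 0 < m) (ξ : R3) : 0 < energy m ξ := hm.trans_le (le_energy ξ)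

lemma continuous_energy (m : ℝ) : Continuous (energy m) := by unfold energy; fun_prop

lemma posSymbol_isHermitian (m : ℝ) (ξ : R3) : (posSymbol m ξ).IsHermitian := by
  have h := diracSymbol_isHermitian m ξ
  unfold Matrix.IsHermitian at h ⊢
  simp [posSymbol, Matrix.conjTranspose_smul, h]

lemma posSymbol_mul_self {m : ℝ} (hm : 0 < m) (ξ : R3) :
    posSymbol m ξ * posSymbol m ξ = posSymbol m ξ := by
  have h := diracSymbol_mul_self m ξ
  have hE : (energy m ξ : ℂ) ≠ 0 := by exact_mod_cast (energy_pos hm ξ).ne'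
  -- The sign H/|H| is an involution, so (1 + H/|H|)/2 is idempotent.
  have h2 : ((energy m ξ)⁻¹ : ℂ) • diracSymbol m ξ * ((energy m ξ)⁻¹ : ℂ) • diracSymbol m ξ
      = 1 := by
    rw [smul_mul_smul_comm, h, smul_smul]
    push_cast
    rw [show (energy m ξ : ℂ)⁻¹ * (energy m ξ : ℂ)⁻¹ * (energy m ξ : ℂ) ^ 2 = 1 by field_simp,
      one_smul]
  unfold posSymbol
  rw [smul_mul_smul_comm, add_mul, mul_add, mul_add, h2]
  simp only [one_mul, mul_one]
  module

lemma act_posSymbol_act_posSymbol {m : ℝ} (hm : 0 < m) (ξ : R3) (v : C4) :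
    act (posSymbol m ξ) (act (posSymbol m ξ) v) = act (posSymbol m ξ) v := by
  conv_rhs => rw [← posSymbol_mul_self hm ξ, act_mul]
  rfl

/-- The symbol is Hermitian and idempotent, so ⟨v, Pv⟩ = ⟨Pv, Pv⟩. With Cauchy-Schwarz this makes P
a contraction. -/
lemma inner_act_posSymbol {m : ℝ} (hm : 0 < m) (ξ : R3) (v : C4) :
    inner ℂ v (act (posSymbol m ξ) v) = (‖act (posSymbol m ξ) v‖ : ℂ) ^ 2 := by
  have h : star (act (posSymbol m ξ)) = act (posSymbol m ξ) := by
    rw [← act_conjTranspose, posSymbol_isHermitian m ξ]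
  conv_lhs => rw [← act_posSymbol_act_posSymbol hm]
  rw [← ContinuousLinearMap.adjoint_inner_left, ← ContinuousLinearMap.star_eq_adjoint, h,
    inner_self_eq_norm_sq_to_K]
  rfl

lemma norm_act_posSymbol_le {m : ℝ} (hm : 0 < m) (ξ : R3) (v : C4) :
    ‖act (posSymbol m ξ) v‖ ≤ ‖v‖ := by
  have h := norm_inner_le_norm (𝕜 := ℂ) v (act (posSymbol m ξ) v)
  rw [inner_act_posSymbol hm, ← Complex.ofReal_pow, Complex.norm_real,
    Real.norm_of_nonneg (by positivity), sq] at h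
  rcases (norm_nonneg (act (posSymbol m ξ) v)).eq_or_lt with h0 | h0
  · rw [← h0]; exact norm_nonneg _
  · exact le_of_mul_le_mul_right h h0

lemma fourier_posProj (m : ℝ) (ψ : L2) :
    (𝓕 (posProj m ψ) : L2) =ᵐ[volume] fun ξ => act (posSymbol m ξ) ((𝓕 ψ : L2) ξ) := by
  rw [posProj, FourierTransform.fourier_fourierInv_eq]
  exact MemLp.coeFn_toLp _

lemma fourier_L2_injective {f g : L2} (h : (𝓕 f : L2) =ᵐ[volume] (𝓕 g : L2)) : f = g :=
  (Lp.fourierTransformₗᵢ R3 C4).injective (Lp.ext h)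

lemma posProj_add (m : ℝ) (f g : L2) : posProj m (f + g) = posProj m f + posProj m g := by
  apply fourier_L2_injective
  rw [FourierTransform.fourier_add (posProj m f)]
  filter_upwards [fourier_posProj m (f + g), fourier_posProj m f, fourier_posProj m g,
    Lp.coeFn_add (𝓕 (posProj m f) : L2) (𝓕 (posProj m g)),
    Lp.coeFn_add (𝓕 f : L2) (𝓕 g)] with ξ h1 h2 h3 h4 h5
  rw [h1, h4, Pi.add_apply, h2, h3, FourierTransform.fourier_add, h5, Pi.add_apply, map_add]

lemma posProj_smul (m : ℝ) (c : ℂ) (f : L2) : posProj m (c • f) = c • posProj m f := by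
  apply fourier_L2_injective
  rw [FourierTransform.fourier_smul c (posProj m f)]
  filter_upwards [fourier_posProj m (c • f), fourier_posProj m f,
    Lp.coeFn_smul c (𝓕 (posProj m f) : L2), Lp.coeFn_smul c (𝓕 f : L2)] with ξ h1 h2 h3 h4
  rw [h1, h3, Pi.smul_apply, h2, FourierTransform.fourier_smul, h4, Pi.smul_apply, map_smul]

lemma posProj_sub (m : ℝ) (f g : L2) : posProj m (f - g) = posProj m f - posProj m g := by
  rw [sub_eq_add_neg, posProj_add, ← neg_one_smul ℂ g, posProj_smul]
  simp [sub_eq_add_neg]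

lemma posProj_posProj {m : ℝ} (hm : 0 < m) (f : L2) :
    posProj m (posProj m f) = posProj m f := by
  apply fourier_L2_injective
  filter_upwards [fourier_posProj m (posProj m f), fourier_posProj m f] with ξ h1 h2
  rw [h1, h2, act_posSymbol_act_posSymbol hm]

lemma posProj_of_mem_Xpos {m : ℝ} (hm : 0 < m) {w : L2} (hw : w ∈ Xpos m) :
    posProj m w = w := by
  obtain ⟨f, -, rfl⟩ := hw
  exact posProj_posProj hm f

lemma posProj_of_mem_Xneg {m : ℝ} (hm : 0 < m) {η : L2} (hη : η ∈ Xneg m) :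
    posProj m η = 0 := by
  obtain ⟨f, -, rfl⟩ := hη
  rw [negProj, posProj_sub, posProj_posProj hm, sub_self]

/-! ### The energy space -/

lemma X_add {f g : L2} (hf : f ∈ X) (hg : g ∈ X) : f + g ∈ X := by
  have h := TemperedDistribution.MemSobolev.add hf hg
  have e := (Lp.toTemperedDistributionCLM C4 (volume : Measure R3) 2).map_add f g
  simp only [Lp.toTemperedDistributionCLM_apply] at e
  rw [← e] at h
  exact h

lemma X_smul (c : ℂ) {f : L2} (hf : f ∈ X) : c • f ∈ X := by
  have h := TemperedDistribution.MemSobolev.smul c hf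
  have e := (Lp.toTemperedDistributionCLM C4 (volume : Measure R3) 2).map_smul c f
  simp only [Lp.toTemperedDistributionCLM_apply] at e
  rw [← e] at h
  exact h

lemma X_posProj {m : ℝ} (hm : 0 < m) {f : L2} (hf : f ∈ X) : posProj m f ∈ X := by
  rw [mem_X_iff hm] at hf ⊢
  refine hf.mono ((continuous_energy m).aestronglyMeasurable.mul
    ((Lp.aestronglyMeasurable _).norm.pow 2)) ?_
  filter_upwards [fourier_posProj m f] with ξ hξ
  rw [hξ, norm_mul, norm_mul]
  simp only [norm_pow, norm_norm]
  gcongr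
  exact norm_act_posSymbol_le hm ξ _

lemma Xpos_subset {m : ℝ} (hm : 0 < m) : Xpos m ⊆ X := by
  rintro _ ⟨f, hf, rfl⟩
  exact X_posProj hm hf

lemma Xneg_subset {m : ℝ} (hm : 0 < m) : Xneg m ⊆ X := by
  rintro _ ⟨f, hf, rfl⟩
  rw [negProj, sub_eq_add_neg, ← neg_one_smul ℂ]
  exact X_add hf (X_smul _ (X_posProj hm hf))

lemma zero_mem_X : (0 : L2) ∈ X := by
  -- X does not depend on the mass, so any positive value may be used.
  rw [mem_X_iff one_pos, FourierTransform.fourier_zero]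
  refine (integrable_congr ?_).2 (integrable_zero R3 ℝ volume)
  filter_upwards with ξ
  simp

lemma posProj_zero (m : ℝ) : posProj m 0 = 0 := by
  simpa using posProj_smul m 0 0

lemma zero_mem_Xneg (m : ℝ) : (0 : L2) ∈ Xneg m :=
  ⟨0, zero_mem_X, by rw [negProj, posProj_zero, sub_zero]⟩

lemma hNorm_nonneg (m : ℝ) (ψ : L2) : 0 ≤ hNorm m ψ := Real.sqrt_nonneg _

lemma hNorm_sq (m : ℝ) (ψ : L2) :
    hNorm m ψ ^ 2 = ∫ ξ : R3, energy m ξ * ‖(𝓕 ψ : L2) ξ‖ ^ 2 :=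
  Real.sq_sqrt (integral_nonneg fun _ => mul_nonneg (Real.sqrt_nonneg _) (by positivity))

lemma hNorm_smul_sq (m : ℝ) (c : ℂ) (ψ : L2) :
    hNorm m (c • ψ) ^ 2 = ‖c‖ ^ 2 * hNorm m ψ ^ 2 := by
  rw [hNorm_sq, hNorm_sq, ← integral_const_mul]
  refine integral_congr_ae ?_
  filter_upwards [Lp.coeFn_smul c (𝓕 ψ : L2)] with ξ hξ
  rw [FourierTransform.fourier_smul, hξ, Pi.smul_apply, norm_smul]
  ring

lemma norm_sq_eq_integral (f : L2) : ‖f‖ ^ 2 = ∫ x : R3, ‖f x‖ ^ 2 := by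
  have h := L2.inner_def (𝕜 := ℂ) f f
  rw [inner_self_eq_norm_sq_to_K] at h
  simp only [inner_self_eq_norm_sq_to_K] at h
  have h2 : ((‖f‖ ^ 2 : ℝ) : ℂ) = ((∫ x : R3, ‖f x‖ ^ 2 : ℝ) : ℂ) := by
    rw [← integral_complex_ofReal]
    push_cast
    exact h
  exact_mod_cast h2

lemma integrable_norm_sq (f : L2) : Integrable (fun x : R3 => ‖f x‖ ^ 2) :=
  (memLp_two_iff_integrable_sq_norm (Lp.aestronglyMeasurable f)).1 (Lp.memLp f)

lemma mul_norm_sq_le_hNorm_sq {m : ℝ} (hm : 0 < m) {ψ : L2} (hψ : ψ ∈ X) :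
    m * ‖ψ‖ ^ 2 ≤ hNorm m ψ ^ 2 := by
  rw [hNorm_sq, ← Lp.norm_fourier_eq, norm_sq_eq_integral, ← integral_const_mul]
  exact integral_mono ((integrable_norm_sq _).const_mul m) ((mem_X_iff hm ψ).1 hψ)
    fun ξ => mul_le_mul_of_nonneg_right (le_energy ξ) (by positivity)

/-- Λ₊ fixes w and kills η, so the quadratic part of the action decouples. -/
lemma action_smul_add (F : C4 → ℝ) {m : ℝ} (hm : 0 < m) (γ a : ℝ) {w η : L2}
    (hw : w ∈ Xpos m) (hη : η ∈ Xneg m) :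
    action F m γ ((a : ℂ) • w + η) = 1 / 2 * (a ^ 2 * hNorm m w ^ 2) - 1 / 2 * hNorm m η ^ 2
      - γ * ∫ x : R3, F (((a : ℂ) • w + η : L2) x) := by
  have h1 : posProj m ((a : ℂ) • w + η) = (a : ℂ) • w := by
    rw [posProj_add, posProj_smul, posProj_of_mem_Xpos hm hw, posProj_of_mem_Xneg hm hη, add_zero]
  rw [action, negProj, h1, add_sub_cancel_left, hNorm_smul_sq, Complex.norm_real,
    Real.norm_eq_abs, sq_abs]

/-! ### The nonlinearity -/

namespace Nonlinearity

variable {F : C4 → ℝ} {α R γbar ρ ν : ℝ}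

lemma apply_nonneg (hF : Nonlinearity F α R γbar ρ ν) (φ : C4) : 0 ≤ F φ :=
  nonneg_of_mul_nonneg_right (hF.nonneg φ) (by linarith [hF.two_lt_alpha])

/-- Since F ≥ 0 and α > 2, 2F(φ) ≤ αF(φ) ≤ ∇F(φ)·φ ≤ |∇F(φ)||φ|. -/
lemma le_of_grad_le (hF : Nonlinearity F α R γbar ρ ν) {μ : ℝ}
    (hμ : ∀ φ, ‖fderiv ℝ F φ‖ ≤ ‖φ‖ + μ * ‖φ‖ ^ (α - 1)) (φ : C4) :
    F φ ≤ 1 / 2 * (‖φ‖ ^ 2 + μ * ‖φ‖ ^ α) := by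
  have h1 : fderiv ℝ F φ φ ≤ ‖fderiv ℝ F φ‖ * ‖φ‖ :=
    (le_abs_self _).trans ((fderiv ℝ F φ).le_opNorm φ)
  have h2 : ‖φ‖ ^ α = ‖φ‖ ^ (α - 1) * ‖φ‖ := by
    rw [← Real.rpow_add_one' (norm_nonneg φ) (by linarith [hF.two_lt_alpha]), sub_add_cancel]
  have h3 := mul_le_mul_of_nonneg_right (hμ φ) (norm_nonneg φ)
  have h4 := mul_le_mul_of_nonneg_right hF.two_lt_alpha.le (hF.apply_nonneg φ)
  have h5 := hF.superquadratic φ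
  rw [h2]
  linarith

/-- Convexity, in first order form. -/
lemma add_fderiv_le (hF : Nonlinearity F α R γbar ρ ν) (φ ξ : C4) :
    F φ + fderiv ℝ F φ ξ ≤ F (φ + ξ) := by
  have hd : Differentiable ℝ F := hF.contDiff.differentiable (by norm_num)
  have hd2 : Differentiable ℝ (fderiv ℝ F) :=
    (hF.contDiff.fderiv_right (m := 1) (by norm_num)).differentiable (by norm_num)
  have hl : ∀ t : ℝ, HasDerivAt (fun t : ℝ => φ + t • ξ) ξ t := fun t => by
    simpa using ((hasDerivAt_id t).smul_const ξ).const_add φ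
  have h1 : ∀ t : ℝ, HasDerivAt (fun t : ℝ => F (φ + t • ξ)) (fderiv ℝ F (φ + t • ξ) ξ) t :=
    fun t => (hd _).hasFDerivAt.comp_hasDerivAt t (hl t)
  have h2 : ∀ t : ℝ, HasDerivAt (fun t : ℝ => fderiv ℝ F (φ + t • ξ) ξ)
      (fderiv ℝ (fderiv ℝ F) (φ + t • ξ) ξ ξ) t := fun t => by
    simpa using ((hd2 _).hasFDerivAt.comp_hasDerivAt t (hl t)).clm_apply (hasDerivAt_const t ξ)
  have hmono : Monotone fun t : ℝ => fderiv ℝ F (φ + t • ξ) ξ :=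
    monotone_of_hasDerivAt_nonneg h2 fun t => hF.convex _ _
  -- By the mean value theorem F(φ + ξ) - F(φ) is the slope at some c in (0, 1). The slope is
  -- nondecreasing, so it dominates its value at 0.
  obtain ⟨c, hc, hce⟩ := exists_hasDerivAt_eq_slope (fun t : ℝ => F (φ + t • ξ))
    (fun t => fderiv ℝ F (φ + t • ξ) ξ) (zero_lt_one' ℝ)
    (fun t _ => (h1 t).continuousAt.continuousWithinAt) (fun t _ => h1 t)
  have h3 := hmono hc.1.le
  simp only [zero_smul, add_zero, one_smul, sub_zero, div_one] at h3 hce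
  linarith

end Nonlinearity

/-! ### Sobolev and Hölder bounds -/

/-- The infimum defining the constant is itself admissible: divide by the norm and pass to the
infimum. A vanishing norm forces ψ = 0, since m|ψ|₂² ≤ ‖ψ‖², and is treated apart. -/
lemma eLpNorm_le_sobolevConst {m : ℝ} (hm : 0 < m) (p : ℝ≥0∞) {ψ : L2} (hψ : ψ ∈ X) :
    eLpNorm ψ p (volume : Measure R3) ≤ sobolevConst m p * ENNReal.ofReal (hNorm m ψ) := by
  rcases (hNorm_nonneg m ψ).eq_or_lt with h | h
  · have h1 := mul_norm_sq_le_hNorm_sq hm hψ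
    rw [← h] at h1
    have h2 : ‖ψ‖ = 0 := by
      by_contra h0
      have : 0 < m * ‖ψ‖ ^ 2 := by positivity
      linarith
    rw [norm_eq_zero] at h2
    rw [h2, eLpNorm_congr_ae (Lp.coeFn_zero C4 2 (volume : Measure R3)), eLpNorm_zero]
    exact zero_le
  · have h0 : ENNReal.ofReal (hNorm m ψ) ≠ 0 := by simpa using h
    rw [← ENNReal.div_le_iff h0 ENNReal.ofReal_ne_top]
    exact le_sInf fun C hC => (ENNReal.div_le_iff h0 ENNReal.ofReal_ne_top).2 (hC ψ hψ)

/-- Hölder's inequality with exponents `2 / (s - 2)` and `2 / (4 - s)`. -/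
lemma lintegral_enorm_rpow_le {Ω V : Type*} [MeasurableSpace Ω] {P : Measure Ω}
    [NormedAddCommGroup V] {s : ℝ} (hs : 2 < s) (hs4 : s < 4)
    {f : Ω → V} (hf : AEStronglyMeasurable f P) :
    ∫⁻ x, ‖f x‖ₑ ^ s ∂P ≤
      eLpNorm f 2 P ^ (s - 2) * eLpNorm f (ENNReal.ofReal (4 / (4 - s))) P ^ 2 := by
  have hs' : 0 < s - 2 := by linarith
  have hs4' : 0 < 4 - s := by linarith
  have hconj : (2 / (s - 2)).HolderConjugate (2 / (4 - s)) := by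
    rw [Real.holderConjugate_iff]
    refine ⟨by rw [one_lt_div hs']; linarith, ?_⟩
    field_simp
    ring
  have hm : AEMeasurable (fun x => ‖f x‖ₑ) P := hf.enorm
  have h := ENNReal.lintegral_mul_le_Lp_mul_Lq P hconj (hm.pow_const (s - 2)) (hm.pow_const (2 : ℝ))
  -- Splitting |f|^s = |f|^(s-2)|f|² places the first factor in the scale of L² and the second in
  -- that of L^(4/(4-s)).
  have e1 : ∀ x, ((fun x => ‖f x‖ₑ ^ (s - 2)) * fun x => ‖f x‖ₑ ^ (2 : ℝ)) x = ‖f x‖ₑ ^ s := by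
    intro x
    rw [Pi.mul_apply, ← ENNReal.rpow_add_of_nonneg _ _ hs'.le zero_le_two, sub_add_cancel]
  simp only [e1, ← ENNReal.rpow_mul] at h
  refine h.trans_eq ?_
  have hq : ENNReal.ofReal (4 / (4 - s)) ≠ 0 :=
    (ENNReal.ofReal_pos.2 (div_pos four_pos hs4')).ne'
  rw [eLpNorm_eq_lintegral_rpow_enorm_toReal two_ne_zero ENNReal.ofNat_ne_top,
    eLpNorm_eq_lintegral_rpow_enorm_toReal hq ENNReal.ofReal_ne_top,
    ENNReal.toReal_ofReal (by positivity), ← ENNReal.rpow_natCast _ 2, ← ENNReal.rpow_mul,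
    ← ENNReal.rpow_mul]
  congr 2
  · congr 1
    ext x
    congr 1
    field_simp
    simp
  · simp
    field_simp
  · congr 1
    ext x
    congr 1
    field_simp
    norm_num
  · push_cast
    field_simp
    norm_num

/-! ### Control of the nonlinear energy by the norm of X, and positivity of the level -/

section

variable {F : C4 → ℝ} {α R γbar ρ ν μ : ℝ}

lemma lintegral_nonlinearity_le (hF : Nonlinearity F α R γbar ρ ν)
    (hμ : ∀ φ, ‖fderiv ℝ F φ‖ ≤ ‖φ‖ + μ * ‖φ‖ ^ (α - 1)) {m : ℝ} (hm : 0 < m)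
    {ψ : L2} (hψ : ψ ∈ X) :
    ∫⁻ x : R3, ENNReal.ofReal (F (ψ x)) ≤ ENNReal.ofReal (1 / 2) *
      ((sobolevConst m 2 ^ 2 + ENNReal.ofReal (μ * ‖ψ‖ ^ (α - 2)) *
        sobolevConst m (ENNReal.ofReal (4 / (4 - α))) ^ 2) * ENNReal.ofReal (hNorm m ψ) ^ 2) := by
  have hα := hF.two_lt_alpha
  have hα' := hF.alpha_le
  have hm0 : AEMeasurable (fun x => ‖ψ x‖ₑ) (volume : Measure R3) :=
    (Lp.aestronglyMeasurable ψ).enorm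
  have h1 : ∀ x : R3, ENNReal.ofReal (F (ψ x)) ≤
      ENNReal.ofReal (1 / 2) * (‖ψ x‖ₑ ^ (2 : ℝ) + ENNReal.ofReal μ * ‖ψ x‖ₑ ^ α) := by
    intro x
    refine (ENNReal.ofReal_le_ofReal (hF.le_of_grad_le hμ (ψ x))).trans ?_
    rw [ENNReal.ofReal_mul (by norm_num)]
    gcongr
    refine ENNReal.ofReal_add_le.trans ?_
    rw [ENNReal.ofReal_mul' (by positivity), ← ENNReal.ofReal_rpow_of_nonneg (norm_nonneg _)
      (by linarith), ofReal_norm, ENNReal.ofReal_pow (norm_nonneg _), ofReal_norm,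
      ← ENNReal.rpow_natCast]
    norm_num
  refine (lintegral_mono h1).trans ?_
  have hma : AEMeasurable (fun x : R3 => ‖ψ x‖ₑ ^ (2 : ℝ) + ENNReal.ofReal μ * ‖ψ x‖ₑ ^ α) :=
    (hm0.pow_const _).add ((hm0.pow_const _).const_mul _)
  rw [lintegral_const_mul'' _ hma,
    lintegral_add_left' (hm0.pow_const _), lintegral_const_mul'' _ (hm0.pow_const _)]
  gcongr
  have h2 : ∫⁻ x, ‖ψ x‖ₑ ^ (2 : ℝ) = eLpNorm ψ 2 (volume : Measure R3) ^ 2 := by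
    rw [eLpNorm_eq_lintegral_rpow_enorm_toReal two_ne_zero ENNReal.ofNat_ne_top,
      ← ENNReal.rpow_natCast _ 2, ← ENNReal.rpow_mul]
    simp
  have h3 : eLpNorm ψ 2 (volume : Measure R3) = ENNReal.ofReal ‖ψ‖ := by
    rw [Lp.norm_def, ENNReal.ofReal_toReal (Lp.eLpNorm_ne_top ψ)]
  rw [add_mul, h2, ← mul_pow, ENNReal.ofReal_mul' (by positivity), mul_assoc, mul_assoc, ← mul_pow,
    ← ENNReal.ofReal_rpow_of_nonneg (norm_nonneg _) (by linarith)]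
  gcongr
  · exact eLpNorm_le_sobolevConst hm _ hψ
  · refine (lintegral_enorm_rpow_le hα (by linarith) (Lp.aestronglyMeasurable ψ)).trans ?_
    rw [h3]
    gcongr
    exact eLpNorm_le_sobolevConst hm _ hψ

variable {m lam γ₀ : ℝ}

lemma integrable_nonlinearity (hF : Nonlinearity F α R γbar ρ ν)
    (hμ : ∀ φ, ‖fderiv ℝ F φ‖ ≤ ‖φ‖ + μ * ‖φ‖ ^ (α - 1)) (hm : 0 < m)
    (hlam : 0 < lam) (hγ₀ : 0 < γ₀)
    (hγ₂ : ENNReal.ofReal γ₀ *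
      (sobolevConst m 2 ^ 2 + ENNReal.ofReal (μ * lam ^ ((α - 2) / 2)) *
        sobolevConst m (ENNReal.ofReal (4 / (4 - α))) ^ 2) < 1 / 4)
    {ψ : L2} (hψ : ψ ∈ X) : Integrable (fun x : R3 => F (ψ x)) := by
  refine ⟨hF.contDiff.continuous.comp_aestronglyMeasurable (Lp.aestronglyMeasurable ψ), ?_⟩
  rw [hasFiniteIntegral_iff_ofReal (Filter.Eventually.of_forall fun x => hF.apply_nonneg _)]
  refine (lintegral_nonlinearity_le hF hμ hm hψ).trans_lt ?_
  -- As γ₀ > 0, the smallness condition forces its bracket to be finite. The mass of ψ is not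
  -- bounded here, so only this finiteness is used.
  have h0 : sobolevConst m 2 ^ 2 + ENNReal.ofReal (μ * lam ^ ((α - 2) / 2)) *
      sobolevConst m (ENNReal.ofReal (4 / (4 - α))) ^ 2 ≠ ⊤ := by
    intro h
    rw [h, ENNReal.mul_top (by simpa using hγ₀)] at hγ₂
    exact not_top_lt hγ₂
  obtain ⟨h1, h2⟩ := ENNReal.add_ne_top.1 h0
  refine ENNReal.mul_lt_top ENNReal.ofReal_lt_top (ENNReal.mul_lt_top
    (ENNReal.add_lt_top.2 ⟨h1.lt_top, ?_⟩) (ENNReal.pow_lt_top ENNReal.ofReal_lt_top))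
  -- For μ ≤ 0 the coefficient is truncated to 0, and the product vanishes even if the Sobolev
  -- constant is infinite. For μ > 0 that constant must be finite.
  rcases le_or_gt μ 0 with hμ0 | hμ0
  · rw [ENNReal.ofReal_of_nonpos (mul_nonpos_of_nonpos_of_nonneg hμ0 (by positivity)), zero_mul]
    exact ENNReal.zero_lt_top
  · refine ENNReal.mul_lt_top ENNReal.ofReal_lt_top (lt_top_iff_ne_top.2 fun h => h2 ?_)
    rw [h, ENNReal.mul_top]
    simpa using by positivity

lemma mul_integral_nonlinearity_le (hF : Nonlinearity F α R γbar ρ ν)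
    (hμ : ∀ φ, ‖fderiv ℝ F φ‖ ≤ ‖φ‖ + μ * ‖φ‖ ^ (α - 1)) (hm : 0 < m)
    (hlam : 0 < lam) (hγ₀ : 0 < γ₀)
    (hγ₂ : ENNReal.ofReal γ₀ *
      (sobolevConst m 2 ^ 2 + ENNReal.ofReal (μ * lam ^ ((α - 2) / 2)) *
        sobolevConst m (ENNReal.ofReal (4 / (4 - α))) ^ 2) < 1 / 4)
    {ψ : L2} (hψ : ψ ∈ X) (hψl : ‖ψ‖ ^ 2 ≤ lam) :
    γ₀ * ∫ x : R3, F (ψ x) ≤ 1 / 8 * hNorm m ψ ^ 2 := by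
  have hα := hF.two_lt_alpha
  -- The mass bound |ψ|₂² ≤ λ enters only here; it makes the smallness condition applicable, and ½ ·
  -- ¼ gives the final ⅛.
  have hpow : ENNReal.ofReal (μ * ‖ψ‖ ^ (α - 2)) ≤ ENNReal.ofReal (μ * lam ^ ((α - 2) / 2)) := by
    rw [ENNReal.ofReal_mul' (by positivity), ENNReal.ofReal_mul' (by positivity)]
    gcongr
    have : ‖ψ‖ ^ (α - 2) = (‖ψ‖ ^ 2) ^ ((α - 2) / 2) := by
      rw [← Real.rpow_natCast, ← Real.rpow_mul (norm_nonneg _)]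
      congr 1
      push_cast
      ring
    rw [this]
    exact Real.rpow_le_rpow (by positivity) hψl (by linarith)
  have hint := integrable_nonlinearity hF hμ hm hlam hγ₀ hγ₂ hψ
  have key : ENNReal.ofReal (γ₀ * ∫ x : R3, F (ψ x)) ≤ ENNReal.ofReal (1 / 8 * hNorm m ψ ^ 2) := by
    rw [ENNReal.ofReal_mul hγ₀.le, ofReal_integral_eq_lintegral_ofReal hint
      (Filter.Eventually.of_forall fun x => hF.apply_nonneg _)]
    calc _ ≤ ENNReal.ofReal γ₀ * (ENNReal.ofReal (1 / 2) *
          ((sobolevConst m 2 ^ 2 + ENNReal.ofReal (μ * lam ^ ((α - 2) / 2)) *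
          sobolevConst m (ENNReal.ofReal (4 / (4 - α))) ^ 2) *
          ENNReal.ofReal (hNorm m ψ) ^ 2)) := by
          gcongr
          refine (lintegral_nonlinearity_le hF hμ hm hψ).trans ?_
          gcongr
      _ = ENNReal.ofReal (1 / 2) * ((ENNReal.ofReal γ₀ *
          (sobolevConst m 2 ^ 2 + ENNReal.ofReal (μ * lam ^ ((α - 2) / 2)) *
          sobolevConst m (ENNReal.ofReal (4 / (4 - α))) ^ 2)) *
          ENNReal.ofReal (hNorm m ψ) ^ 2) := by ring
      _ ≤ ENNReal.ofReal (1 / 2) * (ENNReal.ofReal (1 / 4) * ENNReal.ofReal (hNorm m ψ) ^ 2) := by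
          gcongr
          refine hγ₂.le.trans_eq ?_
          rw [ENNReal.ofReal_div_of_pos (by norm_num)]
          simp
      _ = ENNReal.ofReal (1 / 8 * hNorm m ψ ^ 2) := by
          rw [← ENNReal.ofReal_pow (hNorm_nonneg _ _), ← ENNReal.ofReal_mul (by norm_num),
            ← ENNReal.ofReal_mul (by norm_num)]
          congr 1
          ring
  exact (ENNReal.ofReal_le_ofReal_iff (by positivity)).1 key

/-- Each E(w) is bounded below by its value at η = 0, which is at least (½ - ⅛)λ‖w‖² ≥ ⅜λm. The
bound is uniform in w, so the infimum stays positive. -/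
lemma level_pos (hF : Nonlinearity F α R γbar ρ ν)
    (hμ : ∀ φ, ‖fderiv ℝ F φ‖ ≤ ‖φ‖ + μ * ‖φ‖ ^ (α - 1)) (hm : 0 < m)
    (hlam : 0 < lam) (hγ₀ : 0 < γ₀)
    (hγ₂ : ENNReal.ofReal γ₀ *
      (sobolevConst m 2 ^ 2 + ENNReal.ofReal (μ * lam ^ ((α - 2) / 2)) *
        sobolevConst m (ENNReal.ofReal (4 / (4 - α))) ^ 2) < 1 / 4)
    {γ : ℝ} (hγle : γ ≤ γ₀) : 0 < level F m γ lam := by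
  have h0 : (0 : EReal) < ((3 / 8 * (lam * m) : ℝ) : EReal) := by
    exact_mod_cast (by positivity : (0 : ℝ) < 3 / 8 * (lam * m))
  refine h0.trans_le (le_iInf₂ fun w hw => ?_)
  have hmem : (0 : L2) ∈ ball m lam := ⟨zero_mem_Xneg m, by simpa using hlam⟩
  refine le_trans ?_ (le_iSup₂ (f := fun η _ => ((J F m γ lam w η : ℝ) : EReal)) 0 hmem)
  rw [EReal.coe_le_coe_iff]
  have hwX := Xpos_subset hm hw.1
  set ψ : L2 := ((√lam : ℝ) : ℂ) • w + 0 with hψdef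
  have hψ : ψ ∈ X := X_add (X_smul _ hwX) zero_mem_X
  have hψn : ‖ψ‖ ^ 2 = lam := by
    rw [hψdef, add_zero, norm_smul, mul_pow, hw.2, Complex.norm_real, Real.norm_eq_abs, sq_abs,
      Real.sq_sqrt hlam.le, mul_one]
  have hψh : hNorm m ψ ^ 2 = lam * hNorm m w ^ 2 := by
    rw [hψdef, add_zero, hNorm_smul_sq, Complex.norm_real, Real.norm_eq_abs, sq_abs,
      Real.sq_sqrt hlam.le]
  have h1 := mul_integral_nonlinearity_le hF hμ hm hlam hγ₀ hγ₂ hψ hψn.le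
  have h2 : γ * ∫ x : R3, F (ψ x) ≤ γ₀ * ∫ x : R3, F (ψ x) :=
    mul_le_mul_of_nonneg_right hγle (integral_nonneg fun x => hF.apply_nonneg _)
  have h3 := mul_norm_sq_le_hNorm_sq hm hψ
  have h4 : J F m γ lam w 0 = 1 / 2 * (√lam ^ 2 * hNorm m w ^ 2) - 1 / 2 * hNorm m 0 ^ 2
      - γ * ∫ x : R3, F (ψ x) := by
    rw [J, coeff, norm_zero, zero_pow two_ne_zero, sub_zero,
      action_smul_add F hm γ _ hw.1 (zero_mem_Xneg m)]
  have h5 : hNorm m 0 ^ 2 = 0 := by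
    have := hNorm_smul_sq m 0 0
    simpa using this
  rw [h4, h5, Real.sq_sqrt hlam.le]
  rw [hψn] at h3
  rw [hψh] at h1 h3
  linarith

end

/-! ### Concentrated spinors of positive energy -/

/-- On integrable functions the inverse Fourier transform of `L²` is given by the integral. -/
lemma fourierInv_toLp_ae {f : R3 → C4} (h1 : Integrable f) (h2 : MemLp f 2 (volume : Measure R3)) :
    (𝓕⁻ (h2.toLp f : L2) : L2) =ᵐ[volume] 𝓕⁻ f := by
  have hL : Continuous fun p : R3 × R3 => (-innerₗ R3) p.1 p.2 := by
    simp only [LinearMap.neg_apply, innerₗ_apply_apply]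
    fun_prop
  have hcont : Continuous (𝓕⁻ f) :=
    VectorFourier.fourierIntegral_continuous Real.continuous_fourierChar hL h1
  refine ae_eq_of_integral_contDiff_smul_eq ((Lp.memLp _).locallyIntegrable (by norm_num))
    hcont.locallyIntegrable fun u hu hc => ?_
  have hg₁ : HasCompactSupport (Complex.ofRealCLM ∘ u) := hc.comp_left rfl
  have hg₂ : ContDiff ℝ ((⊤ : ℕ∞) : WithTop ℕ∞) (Complex.ofRealCLM ∘ u) := by fun_prop
  set v : 𝓢(R3, ℂ) := hg₁.toSchwartzMap hg₂ with hv
  -- Both inverse transforms are tested against `v`: the distributional one moves onto `v` by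
  -- definition, the integral one by Fubini and the symmetry of the kernel.
  have h3 := Lp.toTemperedDistribution_apply (𝓕⁻ (h2.toLp f : L2) : L2) v
  rw [← Lp.fourierInv_toTemperedDistribution_eq, TemperedDistribution.fourierInv_apply,
    Lp.toTemperedDistribution_apply] at h3
  have hflip : (-innerₗ R3).flip = -innerₗ R3 := by
    ext x y
    simp [real_inner_comm]
  have h4 := VectorFourier.integral_fourierIntegral_smul_eq_flip (μ := volume) (ν := volume)
    (f := (v : R3 → ℂ)) Real.continuous_fourierChar hL v.integrable h1
  rw [hflip] at h4
  have h5 : ∫ x, (𝓕⁻ v : 𝓢(R3, ℂ)) x • (h2.toLp f : L2) x = ∫ x, v x • 𝓕⁻ f x := by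
    refine (integral_congr_ae ?_).trans h4
    filter_upwards [h2.coeFn_toLp] with x hx
    rw [hx, SchwartzMap.fourierInv_coe]
    rfl
  have h6 := h3.symm.trans h5
  simpa [hv] using h6

/-- The first column of the symbol of the projector `Λ₊`. -/
def column (m : ℝ) (ξ : R3) : C4 := act (posSymbol m ξ) (EuclideanSpace.single 0 1)

/-- Makes the low frequency structure visible: the first entry is real and at least ½, the second
vanishes, and the last two are O(|ξ|/m). Hence β is positive on such spinors at low frequency. -/
lemma column_eq (m : ℝ) (ξ : R3) :
    column m ξ = WithLp.toLp 2 ![((1 / 2 * (1 + (energy m ξ)⁻¹ * m) : ℝ) : ℂ), 0,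
      ((Real.pi * (energy m ξ)⁻¹ : ℝ) : ℂ) * ξ 2,
      ((Real.pi * (energy m ξ)⁻¹ : ℝ) : ℂ) * (ξ 0 + Complex.I * ξ 1)] := by
  ext i
  fin_cases i <;>
    simp [column, act, posSymbol, diracSymbol, Fin.sum_univ_three, alpha, beta, blocks, pauli,
      Matrix.fromBlocks, finSumFinEquiv, Fin.addCases, Matrix.mulVec, dotProduct] <;>
    ring

lemma continuous_column {m : ℝ} (hm : 0 < m) : Continuous (column m) := by
  have : column m = _ := funext (column_eq m)
  rw [this]
  refine (PiLp.continuous_toLp 2 _).comp (continuous_pi fun i => ?_)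
  have hi : Continuous fun ξ => ((energy m ξ : ℂ))⁻¹ :=
    (Complex.continuous_ofReal.comp (continuous_energy m)).inv₀ fun ξ =>
      Complex.ofReal_ne_zero.2 (energy_pos hm ξ).ne'
  fin_cases i <;> simp [-one_div] <;> fun_prop

lemma norm_column_le {m : ℝ} (hm : 0 < m) (ξ : R3) : ‖column m ξ‖ ≤ 1 := by
  simpa [column] using norm_act_posSymbol_le hm ξ (EuclideanSpace.single 0 1)

lemma act_posSymbol_column {m : ℝ} (hm : 0 < m) (ξ : R3) :
    act (posSymbol m ξ) (column m ξ) = column m ξ :=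
  act_posSymbol_act_posSymbol hm ξ _

lemma exists_column_zero {m : ℝ} (hm : 0 < m) (ξ : R3) :
    ∃ t : ℝ, 1 / 2 ≤ t ∧ t ≤ 1 ∧ column m ξ 0 = t := by
  have hE := energy_pos hm ξ
  have h1 : (energy m ξ)⁻¹ * m ≤ 1 := by
    rw [inv_mul_eq_div]
    exact (div_le_one hE).2 (le_energy ξ)
  refine ⟨1 / 2 * (1 + (energy m ξ)⁻¹ * m), ?_, by linarith, by rw [column_eq]; simp⟩
  have : 0 ≤ (energy m ξ)⁻¹ * m := by positivity
  linarith

lemma half_le_norm_column {m : ℝ} (hm : 0 < m) (ξ : R3) : 1 / 2 ≤ ‖column m ξ‖ := by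
  obtain ⟨t, h1, -, h2⟩ := exists_column_zero hm ξ
  have h := PiLp.norm_apply_le (column m ξ) 0
  rw [h2, Complex.norm_real] at h
  exact (h1.trans (le_abs_self t)).trans h

lemma norm_column_two_le {m r : ℝ} (hm : 0 < m) {ξ : R3} (hξ : ‖ξ‖ ≤ r) :
    ‖column m ξ 2‖ ≤ 2 * Real.pi * r / m := by
  have hi : (energy m ξ)⁻¹ ≤ m⁻¹ := inv_anti₀ hm (le_energy ξ)
  have hE := energy_pos hm ξ
  have h2 := PiLp.norm_apply_le ξ 2
  rw [Real.norm_eq_abs] at h2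
  have h0 := norm_nonneg ξ
  rw [column_eq]
  simp only [Fin.isValue, Matrix.cons_val, norm_mul, Complex.norm_real]
  rw [Real.norm_of_nonneg Real.pi_pos.le, norm_inv, Real.norm_of_nonneg hE.le, Real.norm_eq_abs]
  calc Real.pi * (energy m ξ)⁻¹ * |ξ 2| ≤ Real.pi * m⁻¹ * (2 * r) := by
        gcongr
        linarith
    _ = _ := by ring

lemma norm_column_three_le {m r : ℝ} (hm : 0 < m) {ξ : R3} (hξ : ‖ξ‖ ≤ r) :
    ‖column m ξ 3‖ ≤ 2 * Real.pi * r / m := by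
  have hi : (energy m ξ)⁻¹ ≤ m⁻¹ := inv_anti₀ hm (le_energy ξ)
  have hE := energy_pos hm ξ
  have h0 := PiLp.norm_apply_le ξ 0
  have h1 := PiLp.norm_apply_le ξ 1
  have h2 : ‖(ξ 0 : ℂ) + Complex.I * ξ 1‖ ≤ 2 * r := by
    refine (norm_add_le _ _).trans ?_
    rw [norm_mul, Complex.norm_I, one_mul, Complex.norm_real, Complex.norm_real]
    linarith
  rw [column_eq]
  simp only [Fin.isValue, Matrix.cons_val, norm_mul, Complex.norm_real]
  rw [Real.norm_of_nonneg Real.pi_pos.le, norm_inv, Real.norm_of_nonneg hE.le]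
  calc Real.pi * (energy m ξ)⁻¹ * ‖(ξ 0 : ℂ) + Complex.I * ξ 1‖ ≤ Real.pi * m⁻¹ * (2 * r) := by
        gcongr
    _ = _ := by ring

/-- √(m² + t²) ≤ m + t²/(2m) with t = 2πr: near zero frequency the energy exceeds m only to second
order. -/
lemma energy_le {m r : ℝ} (hm : 0 < m) {ξ : R3} (hξ : ‖ξ‖ ≤ r) :
    energy m ξ ≤ m + 2 * Real.pi ^ 2 / m * r ^ 2 := by
  have h0 : 0 ≤ 2 * Real.pi ^ 2 / m * r ^ 2 := by positivity
  have h1 : m * (2 * Real.pi ^ 2 / m * r ^ 2) = 2 * Real.pi ^ 2 * r ^ 2 := by field_simp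
  have h2 : ‖ξ‖ ^ 2 ≤ r ^ 2 := by gcongr
  refine Real.sqrt_le_iff.2 ⟨by positivity, ?_⟩
  nlinarith [sq_nonneg (2 * Real.pi ^ 2 / m * r ^ 2), Real.pi_pos,
    mul_le_mul_of_nonneg_left h2 (sq_nonneg Real.pi)]

/-- The low frequency spinor `𝓕⁻ (truncated m r)` has positive energy. -/
def truncated (m r : ℝ) : R3 → C4 := (Metric.closedBall 0 r).indicator (column m)

lemma norm_truncated_le {m : ℝ} (hm : 0 < m) (r : ℝ) (ξ : R3) :
    ‖truncated m r ξ‖ ≤ (Metric.closedBall (0 : R3) r).indicator (fun _ => (1 : ℝ)) ξ := by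
  rw [truncated, norm_indicator_eq_indicator_norm]
  exact Set.indicator_le_indicator (norm_column_le hm ξ)

lemma memLp_truncated {m : ℝ} (hm : 0 < m) (r : ℝ) (p : ℝ≥0∞) :
    MemLp (truncated m r) p (volume : Measure R3) := by
  have h1 : MemLp ((Metric.closedBall (0 : R3) r).indicator (fun _ => (1 : ℝ))) p
      (volume : Measure R3) :=
    memLp_indicator_const p measurableSet_closedBall 1 (Or.inr measure_closedBall_lt_top.ne)
  refine h1.mono ((continuous_column hm).aestronglyMeasurable.indicator
    measurableSet_closedBall) (Filter.Eventually.of_forall fun ξ => ?_)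
  exact (norm_truncated_le hm r ξ).trans (le_abs_self _)

lemma integrable_truncated {m : ℝ} (hm : 0 < m) (r : ℝ) : Integrable (truncated m r) :=
  memLp_one_iff_integrable.1 (memLp_truncated hm r 1)

lemma norm_fourierInv_truncated_le {m : ℝ} (hm : 0 < m) (r : ℝ) (x : R3) :
    ‖𝓕⁻ (truncated m r) x‖ ≤ (volume : Measure R3).real (Metric.closedBall 0 r) := by
  refine (VectorFourier.norm_fourierIntegral_le_integral_norm _ _ _ _ _).trans ?_
  refine (integral_mono (integrable_truncated hm r).norm ?_ (norm_truncated_le hm r)).trans_eq ?_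
  · exact memLp_one_iff_integrable.1 (memLp_indicator_const 1 measurableSet_closedBall 1
      (Or.inr measure_closedBall_lt_top.ne))
  · rw [integral_indicator measurableSet_closedBall]
    simp

lemma fourierInv_truncated_apply {m : ℝ} (hm : 0 < m) (r : ℝ) (x : R3) (i : Fin 4) :
    𝓕⁻ (truncated m r) x i =
      ∫ ξ in Metric.closedBall 0 r, Complex.exp (↑(2 * Real.pi * inner ℝ ξ x) * Complex.I) *
        column m ξ i := by
  rw [Real.fourierInv_eq']
  have h1 : Integrable fun ξ => Complex.exp (↑(2 * Real.pi * inner ℝ ξ x) * Complex.I) •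
      truncated m r ξ := by
    refine (integrable_truncated hm r).norm.mono' ?_ (Filter.Eventually.of_forall fun ξ => ?_)
    · have hc : Continuous fun ξ : R3 =>
          Complex.exp (↑(2 * Real.pi * inner ℝ ξ x) * Complex.I) := by fun_prop
      exact hc.aestronglyMeasurable.smul (integrable_truncated hm r).1
    · rw [norm_smul, Complex.norm_exp_ofReal_mul_I, one_mul]
  rw [← integral_indicator measurableSet_closedBall]
  have h2 := (EuclideanSpace.proj i : C4 →L[ℂ] ℂ).integral_comp_comm h1
  refine h2.symm.trans ?_
  congr 1
  ext ξ
  by_cases hξ : ξ ∈ Metric.closedBall (0 : R3) r <;> simp [truncated, hξ]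

lemma norm_fourierInv_truncated_apply_le {m : ℝ} (hm : 0 < m) (r : ℝ) (x : R3) (i : Fin 4) {C : ℝ}
    (hC : ∀ ξ : R3, ‖ξ‖ ≤ r → ‖column m ξ i‖ ≤ C) :
    ‖𝓕⁻ (truncated m r) x i‖ ≤ C * (volume : Measure R3).real (Metric.closedBall 0 r) := by
  rw [fourierInv_truncated_apply hm]
  refine norm_setIntegral_le_of_norm_le_const measure_closedBall_lt_top fun ξ hξ => ?_
  rw [norm_mul, Complex.norm_exp_ofReal_mul_I, one_mul]
  exact hC ξ (by simpa using hξ)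

/-- For |ξ| ≤ r and |x| ≤ 1/(6r) the phase 2πξ·x is at most π/3 in modulus. There is thus no
cancellation: the real part of the integrand is at least cos(π/3) · ½ = ¼. -/
lemma le_norm_fourierInv_truncated_apply {m : ℝ} (hm : 0 < m) {r : ℝ} (hr : 0 < r) {x : R3}
    (hx : ‖x‖ ≤ 1 / (6 * r)) :
    1 / 4 * (volume : Measure R3).real (Metric.closedBall 0 r) ≤
      ‖𝓕⁻ (truncated m r) x 0‖ := by
  refine le_trans ?_ (Complex.re_le_norm _)
  rw [fourierInv_truncated_apply hm]
  set f : R3 → ℂ := fun ξ => Complex.exp (↑(2 * Real.pi * inner ℝ ξ x) * Complex.I) *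
    column m ξ 0 with hf
  have hcont : Continuous f := by
    have := continuous_column hm
    have h0 : Continuous fun ξ => column m ξ 0 := by fun_prop
    exact (by fun_prop : Continuous fun ξ : R3 =>
      Complex.exp (↑(2 * Real.pi * inner ℝ ξ x) * Complex.I)).mul h0
  have hint : IntegrableOn f (Metric.closedBall 0 r) :=
    hcont.continuousOn.integrableOn_compact (isCompact_closedBall 0 r)
  have hre : (∫ ξ in Metric.closedBall 0 r, f ξ).re = ∫ ξ in Metric.closedBall 0 r, (f ξ).re :=
    (integral_re hint).symm
  rw [hre]
  have hlow : ∀ ξ ∈ Metric.closedBall (0 : R3) r, 1 / 4 ≤ (f ξ).re := by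
    intro ξ hξ
    have hξ' : ‖ξ‖ ≤ r := by simpa using hξ
    obtain ⟨t, h1, -, h2⟩ := exists_column_zero hm ξ
    have h3 : |2 * Real.pi * inner ℝ ξ x| ≤ Real.pi / 3 := by
      rw [abs_mul, abs_of_pos Real.two_pi_pos]
      have h4 : |inner ℝ ξ x| ≤ r * (1 / (6 * r)) :=
        (abs_real_inner_le_norm ξ x).trans (by gcongr)
      have h5 : r * (1 / (6 * r)) = 1 / 6 := by field_simp
      rw [h5] at h4
      nlinarith [Real.pi_pos]
    have h6 : 1 / 2 ≤ Real.cos (2 * Real.pi * inner ℝ ξ x) := by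
      rw [← Real.cos_pi_div_three, ← Real.cos_abs (2 * Real.pi * inner ℝ ξ x)]
      exact Real.cos_le_cos_of_nonneg_of_le_pi (abs_nonneg _) (by linarith [Real.pi_pos]) h3
    have h7 : (f ξ).re = Real.cos (2 * Real.pi * inner ℝ ξ x) * t := by
      simp only [hf]
      rw [h2, Complex.re_mul_ofReal, Complex.exp_ofReal_mul_I_re]
    rw [h7]
    nlinarith
  have h8 := setIntegral_mono_on (μ := volume) (f := fun _ : R3 => (1 / 4 : ℝ))
    (integrableOn_const measure_closedBall_lt_top.ne) hint.re measurableSet_closedBall hlow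
  refine le_trans (le_of_eq ?_) h8
  simp [mul_comm]

lemma inner_act_beta (v : C4) : inner ℂ v (act beta v) =
    ((‖v 0‖ ^ 2 + ‖v 1‖ ^ 2 - ‖v 2‖ ^ 2 - ‖v 3‖ ^ 2 : ℝ) : ℂ) := by
  simp only [PiLp.inner_apply, Fin.sum_univ_four, act]
  simp [beta, blocks, Matrix.fromBlocks, finSumFinEquiv, Fin.addCases, Matrix.mulVec, dotProduct,
      Fin.sum_univ_four, Complex.mul_conj', mul_comm]
  ring

/-- With V the volume of the frequency ball, the first component is at least V/4 and the last two at
most V/8, and 1/16 - 2/64 = 1/32. -/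
lemma le_norm_inner_fourierInv_truncated {m : ℝ} (hm : 0 < m) {r : ℝ} (hr : 0 < r)
    (hrm : 2 * Real.pi * r / m ≤ 1 / 8) {x : R3} (hx : ‖x‖ ≤ 1 / (6 * r)) :
    1 / 32 * (volume : Measure R3).real (Metric.closedBall 0 r) ^ 2 ≤
      ‖inner ℂ (𝓕⁻ (truncated m r) x) (act beta (𝓕⁻ (truncated m r) x))‖ := by
  rw [inner_act_beta, Complex.norm_real]
  refine le_trans ?_ (le_abs_self _)
  have h0 := le_norm_fourierInv_truncated_apply hm hr hx
  have h2 := norm_fourierInv_truncated_apply_le hm r x 2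
    fun ξ hξ => (norm_column_two_le hm hξ).trans hrm
  have h3 := norm_fourierInv_truncated_apply_le hm r x 3
    fun ξ hξ => (norm_column_three_le hm hξ).trans hrm
  have hV : 0 ≤ (volume : Measure R3).real (Metric.closedBall 0 r) := measureReal_nonneg
  have h0' := pow_le_pow_left₀ (by positivity) h0 2
  have h2' := pow_le_pow_left₀ (norm_nonneg _) h2 2
  have h3' := pow_le_pow_left₀ (norm_nonneg _) h3 2
  nlinarith [sq_nonneg ‖𝓕⁻ (truncated m r) x 1‖]

/-- The normalised inverse transform of `truncated m r`. Its squared L² norm before normalisation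
lies between V/4 and V, because the column has norm between ½ and 1. Dividing the pointwise bounds
V² and V²/32 by it yields 4V and V/32. -/
lemma exists_mem_sphere_concentrated {m : ℝ} (hm : 0 < m) {r : ℝ} (hr : 0 < r)
    (hrm : 2 * Real.pi * r / m ≤ 1 / 8) :
    ∃ w ∈ sphere m, hNorm m w ^ 2 ≤ m + 2 * Real.pi ^ 2 / m * r ^ 2 ∧
      (∀ᵐ x : R3, ‖w x‖ ^ 2 ≤ 4 * (volume : Measure R3).real (Metric.closedBall 0 r)) ∧
      ∀ᵐ x : R3, ‖x‖ ≤ 1 / (6 * r) →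
        1 / 32 * (volume : Measure R3).real (Metric.closedBall 0 r) ≤
          ‖inner ℂ (w x) (act beta (w x))‖ := by
  set V := (volume : Measure R3).real (Metric.closedBall 0 r) with hV
  have hV0 : 0 < V := ENNReal.toReal_pos (Metric.measure_closedBall_pos _ _ hr).ne'
    measure_closedBall_lt_top.ne
  have hL2 := memLp_truncated hm r 2
  set G : L2 := hL2.toLp _ with hG
  have hGae : G =ᵐ[volume] truncated m r := hL2.coeFn_toLp
  have hGn : ‖G‖ ^ 2 = ∫ ξ in Metric.closedBall (0 : R3) r, ‖column m ξ‖ ^ 2 := by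
    rw [norm_sq_eq_integral, ← integral_indicator measurableSet_closedBall]
    refine integral_congr_ae ?_
    filter_upwards [hGae] with ξ hξ
    rw [hξ]
    by_cases h : ξ ∈ Metric.closedBall (0 : R3) r <;> simp [truncated, h]
  have hint : IntegrableOn (fun ξ => ‖column m ξ‖ ^ 2) (Metric.closedBall (0 : R3) r) :=
    ((continuous_column hm).norm.pow 2).continuousOn.integrableOn_compact (isCompact_closedBall 0 r)
  have hconst : ∀ C : ℝ, ∫ _ in Metric.closedBall (0 : R3) r, C = C * V := fun C => by
    simp [hV, mul_comm]
  have hG1 : ‖G‖ ^ 2 ≤ V := by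
    rw [hGn, ← one_mul V, ← hconst]
    refine setIntegral_mono_on hint (integrableOn_const measure_closedBall_lt_top.ne)
      measurableSet_closedBall fun ξ _ => ?_
    exact pow_le_one₀ (norm_nonneg _) (norm_column_le hm ξ)
  have hG2 : 1 / 4 * V ≤ ‖G‖ ^ 2 := by
    rw [hGn, ← hconst]
    refine setIntegral_mono_on (integrableOn_const measure_closedBall_lt_top.ne) hint
      measurableSet_closedBall fun ξ _ => ?_
    nlinarith [half_le_norm_column hm ξ]
  have hGpos : 0 < ‖G‖ ^ 2 := by linarith [mul_pos (by norm_num : (0 : ℝ) < 1 / 4) hV0]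
  have hG0 : 0 < ‖G‖ := by
    rcases (norm_nonneg G).eq_or_lt with h | h
    · rw [← h] at hGpos; norm_num at hGpos
    · exact h
  set w : L2 := ((‖G‖⁻¹ : ℝ) : ℂ) • (𝓕⁻ G : L2) with hw
  have hFw : (𝓕 w : L2) = ((‖G‖⁻¹ : ℝ) : ℂ) • G := by
    rw [hw, FourierTransform.fourier_smul, FourierTransform.fourier_fourierInv_eq]
  have hFwae : (𝓕 w : L2) =ᵐ[volume] fun ξ => ((‖G‖⁻¹ : ℝ) : ℂ) • truncated m r ξ := by
    rw [hFw]
    filter_upwards [Lp.coeFn_smul ((‖G‖⁻¹ : ℝ) : ℂ) G, hGae] with ξ h1 h2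
    rw [h1, Pi.smul_apply, h2]
  have hwn : ‖w‖ = 1 := by
    rw [← Lp.norm_fourier_eq, hFw, norm_smul, Complex.norm_real, norm_inv, norm_norm,
      inv_mul_cancel₀ hG0.ne']
  -- Outside the ball the transform of `w` vanishes, so the low frequency energy bound holds
  -- everywhere.
  have hle : ∀ᵐ ξ : R3, energy m ξ * ‖(𝓕 w : L2) ξ‖ ^ 2 ≤
      (m + 2 * Real.pi ^ 2 / m * r ^ 2) * ‖(𝓕 w : L2) ξ‖ ^ 2 := by
    filter_upwards [hFwae] with ξ hξ
    by_cases h : ξ ∈ Metric.closedBall (0 : R3) r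
    · gcongr
      exact energy_le hm (by simpa using h)
    · rw [hξ]
      simp [truncated, h]
  have hwX : w ∈ X := by
    rw [mem_X_iff hm]
    refine ((integrable_norm_sq (𝓕 w : L2)).const_mul (m + 2 * Real.pi ^ 2 / m * r ^ 2)).mono'
      ((continuous_energy m).aestronglyMeasurable.mul
        ((Lp.aestronglyMeasurable _).norm.pow 2)) ?_
    filter_upwards [hle] with ξ hξ
    rwa [Real.norm_of_nonneg (mul_nonneg (energy_pos hm ξ).le (by positivity))]
  have hwP : posProj m w = w := by
    apply fourier_L2_injective
    filter_upwards [fourier_posProj m w, hFwae] with ξ h1 h2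
    rw [h1, h2, map_smul]
    by_cases h : ξ ∈ Metric.closedBall (0 : R3) r <;> simp [truncated, h, act_posSymbol_column hm]
  have hwae : w =ᵐ[volume] fun x => ((‖G‖⁻¹ : ℝ) : ℂ) • 𝓕⁻ (truncated m r) x := by
    filter_upwards [Lp.coeFn_smul ((‖G‖⁻¹ : ℝ) : ℂ) (𝓕⁻ G : L2),
      fourierInv_toLp_ae (integrable_truncated hm r) hL2] with x h1 h2
    rw [h1, Pi.smul_apply, h2]
  refine ⟨w, ⟨⟨w, hwX, hwP⟩, by rw [hwn, one_pow]⟩, ?_, ?_, ?_⟩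
  · rw [hNorm_sq]
    refine (integral_mono_ae ((mem_X_iff hm w).1 hwX)
      ((integrable_norm_sq (𝓕 w : L2)).const_mul _) hle).trans_eq ?_
    rw [integral_const_mul, ← norm_sq_eq_integral, Lp.norm_fourier_eq, hwn, one_pow, mul_one]
  · filter_upwards [hwae] with x hx
    rw [hx, norm_smul, Complex.norm_real, norm_inv, norm_norm, mul_pow, inv_pow,
      inv_mul_le_iff₀ hGpos]
    have h1 := pow_le_pow_left₀ (norm_nonneg _) (norm_fourierInv_truncated_le hm r x) 2
    nlinarith
  · filter_upwards [hwae] with x hx hxr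
    have h1 := le_norm_inner_fourierInv_truncated hm hr hrm hxr
    rw [hx, map_smul, inner_smul_left, inner_smul_right, norm_mul, norm_mul, Complex.conj_ofReal,
      Complex.norm_real, norm_inv, norm_norm, ← mul_assoc, ← sq, inv_pow,
      le_inv_mul_iff₀ hGpos]
    nlinarith

/-! ### Convexity estimate for the nonlinear energy -/

section

variable {F : C4 → ℝ} {α R γbar ρ ν m γ lam : ℝ}

/-- The nonlinear energy is bounded below through convexity, the linear term being absorbed by
the mass of `η`. -/
lemma le_integral_nonlinearity_add (hF : Nonlinearity F α R γbar ρ ν) (hm : 0 < m) (hγ : 0 < γ)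
    {a : ℝ} {w η : L2} {M T : ℝ} (ha0 : 0 ≤ a) (ha1 : a ≤ 1) (hw : ‖w‖ ^ 2 = 1)
    (hwM : ∀ᵐ x : R3, ‖w x‖ ^ 2 ≤ M) (hMρ : M < ρ ^ 2)
    {B : Set R3} (hB : MeasurableSet B) (hBfin : volume B ≠ ⊤)
    (hwB : ∀ᵐ x : R3, x ∈ B → T ≤ ‖inner ℂ (w x) (act beta (w x))‖) (hT : 0 ≤ T)
    (hint : Integrable fun x : R3 => F (((a : ℂ) • w + η : L2) x)) :
    γ * (γbar * (a ^ 2 * T) ^ (α / 2) * (volume : Measure R3).real B) - m * ‖η‖ ^ 2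
      - γ ^ 2 / (4 * m) * M ^ (ν - 1) ≤
    γ * ∫ x : R3, F (((a : ℂ) • w + η : L2) x) := by
  have hα := hF.two_lt_alpha
  have hν := hF.alpha_half_lt_nu
  have hlow : ∀ᵐ x : R3, γ * B.indicator (fun _ => γbar * (a ^ 2 * T) ^ (α / 2)) x
      - m * ‖η x‖ ^ 2 - γ ^ 2 / (4 * m) * M ^ (ν - 1) * ‖w x‖ ^ 2 ≤
      γ * F (((a : ℂ) • w + η : L2) x) := by
    filter_upwards [hwM, hwB, Lp.coeFn_add ((a : ℂ) • w) η, Lp.coeFn_smul (a : ℂ) w]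
      with x h1 h2 h3 h4
    rw [h3, Pi.add_apply, h4, Pi.smul_apply]
    set φ : C4 := (a : ℂ) • w x with hφ
    have hφn : ‖φ‖ ≤ ‖w x‖ := by
      rw [hφ, norm_smul, Complex.norm_real, Real.norm_of_nonneg ha0]
      exact mul_le_of_le_one_left (norm_nonneg _) ha1
    have hφρ : ‖φ‖ < ρ :=
      hφn.trans_lt (lt_of_pow_lt_pow_left₀ 2 hF.rho_pos.le (h1.trans_lt hMρ))
    have hconv := hF.add_fderiv_le φ (η x)
    have hFφ : B.indicator (fun _ => γbar * (a ^ 2 * T) ^ (α / 2)) x ≤ F φ := by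
      by_cases hx : x ∈ B
      · rw [Set.indicator_of_mem hx]
        refine le_trans ?_ (hF.lower φ hφρ)
        have h5 : a ^ 2 * T ≤ ‖inner ℂ φ (act beta φ)‖ := by
          rw [hφ, map_smul, inner_smul_left, inner_smul_right, norm_mul, norm_mul,
            Complex.conj_ofReal, Complex.norm_real, Real.norm_of_nonneg ha0, ← mul_assoc, ← sq]
          exact mul_le_mul_of_nonneg_left (h2 hx) (by positivity)
        have := hF.gammabar_pos
        gcongr
      · rw [Set.indicator_of_notMem hx]
        exact hF.apply_nonneg φ
    -- Since |w|^(2ν) = (|w|²)^(ν-1)|w|² and ν > 1, the sup bound M controls the first factor, while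
    -- the second integrates to 1.
    have hgrad : ‖fderiv ℝ F φ‖ ^ 2 ≤ M ^ (ν - 1) * ‖w x‖ ^ 2 := by
      have h6 : ‖fderiv ℝ F φ‖ ≤ ‖w x‖ ^ ν :=
        (hF.grad_le φ hφρ).trans (Real.rpow_le_rpow (norm_nonneg _) hφn (by linarith))
      calc ‖fderiv ℝ F φ‖ ^ 2 ≤ (‖w x‖ ^ ν) ^ 2 := by gcongr
        _ = (‖w x‖ ^ 2) ^ (ν - 1) * ‖w x‖ ^ 2 := by
          rw [← Real.rpow_add_one' (by positivity) (by linarith), sub_add_cancel,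
            ← Real.rpow_mul_natCast (norm_nonneg _), ← Real.rpow_natCast_mul (norm_nonneg _),
            mul_comm]
        _ ≤ M ^ (ν - 1) * ‖w x‖ ^ 2 := by
          gcongr
          linarith
    have hlin : -(‖fderiv ℝ F φ‖ * ‖η x‖) ≤ fderiv ℝ F φ (η x) :=
      (abs_le.1 ((fderiv ℝ F φ).le_opNorm (η x))).1
    -- The weight m is forced: replacing part of the mass of w by η lowers the quadratic part by
    -- exactly m|η|₂², up to the small kinetic correction.
    have hyoung : γ * (‖fderiv ℝ F φ‖ * ‖η x‖) ≤
        m * ‖η x‖ ^ 2 + γ ^ 2 / (4 * m) * ‖fderiv ℝ F φ‖ ^ 2 := by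
      have h7 : m * ‖η x‖ ^ 2 + γ ^ 2 / (4 * m) * ‖fderiv ℝ F φ‖ ^ 2
          - γ * (‖fderiv ℝ F φ‖ * ‖η x‖) =
          (2 * m * ‖η x‖ - γ * ‖fderiv ℝ F φ‖) ^ 2 / (4 * m) := by
        field_simp
        ring
      have h8 : 0 ≤ (2 * m * ‖η x‖ - γ * ‖fderiv ℝ F φ‖) ^ 2 / (4 * m) := by positivity
      linarith
    have h9 := mul_le_mul_of_nonneg_left hgrad (by positivity : 0 ≤ γ ^ 2 / (4 * m))
    have h10 := mul_le_mul_of_nonneg_left hFφ hγ.le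
    have h11 := mul_le_mul_of_nonneg_left hconv hγ.le
    have h12 := mul_le_mul_of_nonneg_left hlin hγ.le
    linarith
  have i1 : Integrable fun x : R3 =>
      γ * B.indicator (fun _ => γbar * (a ^ 2 * T) ^ (α / 2)) x :=
    ((integrable_indicator_iff hB).2 (integrableOn_const hBfin)).const_mul γ
  have i2 := (integrable_norm_sq η).const_mul m
  have i3 := (integrable_norm_sq w).const_mul (γ ^ 2 / (4 * m) * M ^ (ν - 1))
  have h := integral_mono_ae ((i1.sub i2).sub i3) (hint.const_mul γ) hlow
  have e := integral_sub (i1.sub i2) i3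
  simp only [Pi.sub_apply] at e h
  rw [e, integral_sub i1 i2, integral_const_mul, integral_const_mul, integral_const_mul,
    integral_const_mul, integral_indicator hB, setIntegral_const, ← norm_sq_eq_integral,
    ← norm_sq_eq_integral, hw, smul_eq_mul, mul_one] at h
  linarith

end

/-- For small `r` the power `r ^ s` dominates `r ^ 2` and `r ^ t`. -/
lemma eventually_mul_rpow_lt {A D G s t : ℝ} (hG : 0 < G) (hs : s < 2) (hst : s < t) :
    ∀ᶠ r : ℝ in nhdsWithin 0 (Set.Ioi 0), A * r ^ 2 + D * r ^ t < G * r ^ s := by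
  have hlim : ∀ u : ℝ, 0 < u →
      Filter.Tendsto (fun r : ℝ => r ^ u) (nhdsWithin 0 (Set.Ioi 0)) (nhds 0) := fun u hu => by
    have h := (Real.continuousAt_rpow_const 0 u (Or.inr hu.le)).tendsto
    rw [Real.zero_rpow hu.ne'] at h
    exact h.mono_left nhdsWithin_le_nhds
  have h := ((hlim (2 - s) (by linarith)).const_mul A).add
    ((hlim (t - s) (by linarith)).const_mul D)
  rw [mul_zero, mul_zero, add_zero] at h
  filter_upwards [h.eventually_lt_const hG, self_mem_nhdsWithin] with r hr hr0
  have hr0' : 0 < r := hr0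
  have h1 := mul_lt_mul_of_pos_right hr (Real.rpow_pos_of_pos hr0' s)
  have e1 : r ^ (2 - s) * r ^ s = r ^ 2 := by
    rw [← Real.rpow_add hr0', sub_add_cancel, ← Real.rpow_natCast]
    norm_num
  have e2 : r ^ (t - s) * r ^ s = r ^ t := by
    rw [← Real.rpow_add hr0', sub_add_cancel]
  rwa [add_mul, mul_assoc, mul_assoc, e1, e2] at h1

lemma volume_real_closedBall {r : ℝ} (hr : 0 ≤ r) :
    (volume : Measure R3).real (Metric.closedBall 0 r) =
      r ^ 3 * (volume : Measure R3).real (Metric.ball 0 1) := by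
  rw [Measure.addHaar_real_closedBall _ _ hr, finrank_euclideanSpace_fin]

/-! ### The strict upper bound on the level -/

section

variable {F : C4 → ℝ} {α R γbar ρ ν μ m lam γ₀ γ : ℝ}

lemma level_lt (hF : Nonlinearity F α R γbar ρ ν)
    (hμ : ∀ φ, ‖fderiv ℝ F φ‖ ≤ ‖φ‖ + μ * ‖φ‖ ^ (α - 1)) (hm : 0 < m)
    (hlam : 0 < lam) (hlam1 : lam ≤ 1) (hγ₀ : 0 < γ₀)
    (hγ₂ : ENNReal.ofReal γ₀ *
      (sobolevConst m 2 ^ 2 + ENNReal.ofReal (μ * lam ^ ((α - 2) / 2)) *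
        sobolevConst m (ENNReal.ofReal (4 / (4 - α))) ^ 2) < 1 / 4)
    (hγ : 0 < γ) : level F m γ lam < ((lam * m / 2 : ℝ) : EReal) := by
  have hα := hF.two_lt_alpha
  have hα' := hF.alpha_le
  have hν := hF.alpha_half_lt_nu
  have hγbar := hF.gammabar_pos
  set κ := (volume : Measure R3).real (Metric.ball 0 1) with hκ
  have hκ0 : 0 < κ := ENNReal.toReal_pos (Metric.measure_ball_pos _ _ one_pos).ne'
    measure_ball_lt_top.ne
  set C : ℝ := 2 * Real.pi ^ 2 / m with hC
  -- Coefficients of gain and loss after extracting powers of r, the volume of the frequency ball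
  -- being κr³. In `G`, λ/2 bounds a² from below, and κ/6³ comes from the ball of radius 1/(6r),
  -- whose volume supplies the factor r⁻³.
  set G : ℝ := γ * (γbar * (lam / 2 * (1 / 32 * κ)) ^ (α / 2) * (1 / 6 ^ 3 * κ)) with hG
  set D : ℝ := γ ^ 2 / (4 * m) * (4 * κ) ^ (ν - 1) with hD
  have hG0 : 0 < G := by positivity
  have small : ∀ f : ℝ → ℝ, Continuous f → f 0 = 0 → ∀ c : ℝ, 0 < c →
      ∀ᶠ r in nhdsWithin 0 (Set.Ioi 0), f r < c := by
    intro f hf h0 c hc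
    have h1 := hf.tendsto 0
    rw [h0] at h1
    exact (h1.mono_left nhdsWithin_le_nhds).eventually_lt_const hc
  have hev : ∀ᶠ r : ℝ in nhdsWithin 0 (Set.Ioi 0), 0 < r ∧ 2 * Real.pi * r / m < 1 / 8 ∧
      4 * (r ^ 3 * κ) < ρ ^ 2 ∧ C * r ^ 2 < m / 2 ∧
      lam * C / 2 * r ^ 2 + D * r ^ (3 * (ν - 1)) < G * r ^ (3 * (α / 2) - 3) := by
    filter_upwards [self_mem_nhdsWithin,
      small (fun r => 2 * Real.pi * r / m) (by fun_prop) (by simp) (1 / 8) (by norm_num),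
      small (fun r => 4 * (r ^ 3 * κ)) (by fun_prop) (by simp) (ρ ^ 2) (pow_pos hF.rho_pos 2),
      small (fun r => C * r ^ 2) (by fun_prop) (by simp) (m / 2) (by positivity),
      eventually_mul_rpow_lt (A := lam * C / 2) (D := D) hG0
        (by linarith : 3 * (α / 2) - 3 < 2) (by linarith : 3 * (α / 2) - 3 < 3 * (ν - 1))]
      with r h1 h2 h3 h4 h5
    exact ⟨h1, h2, h3, h4, h5⟩
  obtain ⟨r, hr, hr1, hr2, hr3, hr4⟩ := hev.exists
  obtain ⟨w, hw, hwh, hwM, hwB⟩ := exists_mem_sphere_concentrated hm hr hr1.le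
  rw [volume_real_closedBall hr.le] at hwM hwB
  have hwX := Xpos_subset hm hw.1
  set gap : ℝ := G * r ^ (3 * (α / 2) - 3) - (lam * C / 2 * r ^ 2 + D * r ^ (3 * (ν - 1)))
    with hgap
  -- A gap independent of η is needed, since a supremum of strictly smaller values could still reach
  -- λm/2.
  have hτ : 0 < min gap (lam * m / 4) := lt_min (sub_pos.2 hr4) (by positivity)
  have hbound : E F m γ lam w ≤ ((lam * m / 2 - min gap (lam * m / 4) : ℝ) : EReal) := by
    refine iSup₂_le fun η hη => ?_
    rw [EReal.coe_le_coe_iff]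
    set a := coeff lam η with ha
    have ha0 : 0 ≤ a := Real.sqrt_nonneg _
    have hn : ‖η‖ ^ 2 < lam := hη.2
    have ha2 : a ^ 2 = lam - ‖η‖ ^ 2 := Real.sq_sqrt (by linarith)
    have ha1 : a ≤ 1 := by
      have := sq_nonneg ‖η‖
      exact (sq_le_one_iff₀ ha0).1 (by linarith)
    have hηX := Xneg_subset hm hη.1
    have hJ : J F m γ lam w η = 1 / 2 * (a ^ 2 * hNorm m w ^ 2) - 1 / 2 * hNorm m η ^ 2
        - γ * ∫ x : R3, F (((a : ℂ) • w + η : L2) x) :=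
      action_smul_add F hm γ a hw.1 hη.1
    have hηh := mul_norm_sq_le_hNorm_sq hm hηX
    have hint := integrable_nonlinearity hF hμ hm hlam hγ₀ hγ₂ (X_add (X_smul (a : ℂ) hwX) hηX)
    have hCr : 0 ≤ C * r ^ 2 := by positivity
    have hkin : a ^ 2 * hNorm m w ^ 2 ≤ (lam - ‖η‖ ^ 2) * m + lam * (C * r ^ 2) := by
      have h1 := mul_le_mul_of_nonneg_left hwh (sq_nonneg a)
      rw [ha2] at h1 ⊢
      nlinarith [mul_nonneg (sq_nonneg ‖η‖) hCr]
    rw [hJ]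
    -- A large η makes a small and the nonlinear gain useless. In that case J ≤ λm/2 - m|η|₂² +
    -- λCr²/2 ≤ λm/4 already.
    rcases le_or_gt (lam / 2) (‖η‖ ^ 2) with hcase | hcase
    · have h1 : 0 ≤ γ * ∫ x : R3, F (((a : ℂ) • w + η : L2) x) :=
        mul_nonneg hγ.le (integral_nonneg fun x => hF.apply_nonneg _)
      have h2 := mul_le_mul_of_nonneg_left hcase hm.le
      have h3 := mul_le_mul_of_nonneg_left hr3.le hlam.le
      have h4 := min_le_right gap (lam * m / 4)
      linarith
    -- Here a² > λ/2, and the -m|η|₂² of the quadratic part cancels the Young term, leaving `gap`.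
    · have h1 := le_integral_nonlinearity_add hF hm hγ ha0 ha1 hw.2 hwM hr2
        (B := Metric.closedBall 0 (1 / (6 * r))) measurableSet_closedBall
        measure_closedBall_lt_top.ne (by simpa only [mem_closedBall_zero_iff] using hwB)
        (by positivity) hint
      rw [volume_real_closedBall (by positivity)] at h1
      have hgain : G * r ^ (3 * (α / 2) - 3) ≤
          γ * (γbar * (a ^ 2 * (1 / 32 * (r ^ 3 * κ))) ^ (α / 2) *
            ((1 / (6 * r)) ^ 3 * κ)) := by
        have e1 : (lam / 2 * (1 / 32 * (r ^ 3 * κ))) ^ (α / 2) =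
            (lam / 2 * (1 / 32 * κ)) ^ (α / 2) * r ^ (3 * (α / 2)) := by
          rw [show lam / 2 * (1 / 32 * (r ^ 3 * κ)) = lam / 2 * (1 / 32 * κ) * r ^ 3 by ring,
            Real.mul_rpow (by positivity) (by positivity), ← Real.rpow_natCast_mul hr.le]
          norm_num
        have e2 : G * r ^ (3 * (α / 2) - 3) =
            γ * (γbar * (lam / 2 * (1 / 32 * (r ^ 3 * κ))) ^ (α / 2) *
            ((1 / (6 * r)) ^ 3 * κ)) := by
          have e3 : r ^ (3 * (α / 2) - 3) = r ^ (3 * (α / 2)) / r ^ 3 := by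
            rw [Real.rpow_sub hr, ← Real.rpow_natCast]
            norm_num
          rw [e1, e3, hG]
          field_simp
        rw [e2]
        have : lam / 2 ≤ a ^ 2 := by linarith
        gcongr
      have hloss : γ ^ 2 / (4 * m) * (4 * (r ^ 3 * κ)) ^ (ν - 1) = D * r ^ (3 * (ν - 1)) := by
        rw [show 4 * (r ^ 3 * κ) = 4 * κ * r ^ 3 by ring,
          Real.mul_rpow (by positivity) (by positivity), ← Real.rpow_natCast_mul hr.le, hD]
        push_cast
        ring
      rw [hloss] at h1
      have h4 := min_le_left gap (lam * m / 4)
      linarith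
  refine ((iInf₂_le w hw).trans hbound).trans_lt ?_
  rw [EReal.coe_lt_coe_iff]
  linarith

end

end NLDirac

end

theorem mainTheorem4 (F : NLDirac.C4 → ℝ) (α R γbar ρ ν : ℝ)
    (hF : NLDirac.Nonlinearity F α R γbar ρ ν)
    (m : ℝ) (hm : 0 < m)
    (μ : ℝ) (hμ : ∀ φ, ‖fderiv ℝ F φ‖ ≤ ‖φ‖ + μ * ‖φ‖ ^ (α - 1))
    (lam : ℝ) (hlam : 0 < lam) (hlam1 : lam ≤ 1)
    (γ₀ : ℝ) (hγ₀ : 0 < γ₀)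
    (hγ₁ : ENNReal.ofReal γ₀ *
      (NLDirac.sobolevConst m 2 ^ 2 + ENNReal.ofReal (μ * lam ^ ((α - 2) / 2)) *
        NLDirac.sobolevConst m 3 ^ (3 * (α - 2)) *
        NLDirac.sobolevConst m 2 ^ (3 * α - 8)) < 1 / 16)
    (hγ₂ : ENNReal.ofReal γ₀ *
      (NLDirac.sobolevConst m 2 ^ 2 + ENNReal.ofReal (μ * lam ^ ((α - 2) / 2)) *
        NLDirac.sobolevConst m (ENNReal.ofReal (4 / (4 - α))) ^ 2) < 1 / 4)
    (γ : ℝ) (hγ : 0 < γ) (hγle : γ ≤ γ₀) :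
    0 < NLDirac.level F m γ lam ∧
      NLDirac.level F m γ lam < ((lam * m / 2 : ℝ) : EReal) := by
  exact ⟨NLDirac.level_pos hF hμ hm hlam hγ₀ hγ₂ hγle,
    NLDirac.level_lt hF hμ hm hlam hlam1 hγ₀ hγ₂ hγ⟩
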